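/- Let $M$ be a $C^\infty$ manifold of dimension $n$, and let $(M,\mathcal F)$ be a Finsler manifold: $\mathcal F\colon TM\to[0,\infty)$ is continuous, positively $1$-homogeneous on each tangent space, $C^\infty$ on $TM\setminus\{0\}$, and $g_{x,y}(u,v)=\tfrac12\frac{\partial^2}{\partial s\,\partial t}\big|_{s=t=0}\mathcal F^2(x,y+su+tv)$ is positive definite for all $x\in M$, $y\in T_xM\setminus\{0\}$. Let $p\in M$ and let $\mathcal I_p=\{y\in T_pM:\mathcal F(p,y)=1\}$ be the indicatrix at $p$, a hypersurface of $T_pM$. Denote by $\mathfrak X(\mathcal I_p)$ the Lie algebra of $C^\infty$ vector fields on $\mathcal I_p$ and by $\mathrm{Diff}^\infty(\mathcal I_p)$ the group of its $C^\infty$ diffeomorphisms. In local coordinates let $G^i=\tfrac14 g^{il}\bigl(2\frac{\partial g_{jl}}{\partial x^k}-\frac{\partial g_{jk}}{\partial x^l}\bigr)y^jy^k$ and $G^i_j=\partial G^i/\partial y^j$. A continuous vector field $X(t)$ along a piecewise $C^1$ curve $c\colon[0,1]\to M$ is parallel if $\dot X^i+G^i_j(c,X)\,\dot c^j=0$ except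 at finitely many times; parallel translation along $c$ sends $X(0)$ to $X(1)$. The holonomy group $\mathrm{Hol}_p(M)\subset \mathrm{Diff}^\infty(\mathcal I_p)$ is the subgroup generated by the parallel translations $\mathcal I_p\to\mathcal I_p$ along piecewise $C^1$ closed curves starting at $p$. A vector field $X\in\mathfrak X(\mathcal I_p)$ is tangent to a subgroup $\mathcal G\subset\mathrm{Diff}^\infty(\mathcal I_p)$ if there are an $\varepsilon>0$, a $C^\infty$ curve $(-\varepsilon,\varepsilon)\ni t\mapsto\varphi_t\in\mathcal G$ (that is, $(t,y)\mapsto\varphi_t(y)$ is $C^\infty$) and an integer $k\ge1$ such that $\varphi_0=\mathrm{id}$ and, for all $y\in\mathcal I_p$, $\frac{\partial^i\varphi_t(y)}{\partial t^i}\big|_{t=0}=0$ for $1\le i<k$ and $\frac{\partial^k\varphi_t(y)}{\partial t^k}\big|_{t=0}=X(y)$. The holonomy algebra $\mathfrak{hol}_p(M)$ is the set of all vector fields $X\in\mathfrak X(\mathcal I_p)$ tangent to $\mathrm{Hol}_p(M)$. Theorem. The holonomy algebra $\mathfrak{hol}_p(M)$ is a Lie subalgebra of $\mathfrak X(\mathcal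 I_p)$. -/

import Mathlib

open Set Filter
open scoped Manifold ContDiff Topology

noncomputable section

/-! ### Smooth maps on subsets of normed spaces -/

/-- A map `f` defined on a subset `A` of a normed space is smooth if near every point of `A` it is
the restriction of a `C^∞` map defined on an open subset of the ambient space. For embedded
submanifolds this is the usual notion of a smooth map. -/
def SmoothOnSubset {W V : Type*} [NormedAddCommGroup W] [NormedSpace ℝ W]
    [NormedAddCommGroup V] [NormedSpace ℝ V] (A : Set W) (f : A → V) : Prop :=
  ∀ a : A, ∃ U : Set W, IsOpen U ∧ (a : W) ∈ U ∧
    ∃ g : W → V, ContDiffOn ℝ ∞ g U ∧ ∀ b : A, (b : W) ∈ U → g b = f b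

/-! ### Minkowski norms on vector spaces -/

/-- `g_y(u, v) = (1/2) ∂²/∂s∂t f²(y + s u + t v)` at `s = t = 0`. -/
def fundamentalForm {V : Type*} [AddCommGroup V] [Module ℝ V] (f : V → ℝ) (y u v : V) : ℝ :=
  (1 / 2) * deriv (fun s : ℝ => deriv (fun t : ℝ => f (y + s • u + t • v) ^ 2) 0) 0

/-- A Minkowski norm: a nonnegative, positively 1-homogeneous function, smooth away from the
origin, with positive definite fundamental form at each nonzero vector. -/
structure MinkowskiNorm (V : Type*) [NormedAddCommGroup V] [NormedSpace ℝ V] where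
  toFun : V → ℝ
  nonneg : ∀ y, 0 ≤ toFun y
  homogeneous : ∀ (c : ℝ) (y : V), 0 < c → toFun (c • y) = c * toFun y
  smooth : ContDiffOn ℝ ∞ toFun {0}ᶜ
  posDef : ∀ y u : V, y ≠ 0 → u ≠ 0 → 0 < fundamentalForm toFun y u u

theorem fundamentalForm_self {V : Type*} [AddCommGroup V] [Module ℝ V] (f : V → ℝ)
    (hf : ∀ (c : ℝ) (y : V), 0 < c → f (c • y) = c * f y) (y : V) :
    fundamentalForm f y y y = f y ^ 2 := by
  have key : ∀ s t : ℝ, 0 < 1 + s + t → f (y + s • y + t • y) ^ 2 = (1 + s + t) ^ 2 * f y ^ 2 := by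
    intro s t h
    have : y + s • y + t • y = (1 + s + t) • y := by
      rw [add_smul, add_smul, one_smul]
    rw [this, hf _ _ h]
    ring
  have h1 : ∀ s : ℝ, 0 < 1 + s →
      deriv (fun t : ℝ => f (y + s • y + t • y) ^ 2) 0 = 2 * (1 + s) * f y ^ 2 := by
    intro s hs
    have e : (fun t : ℝ => f (y + s • y + t • y) ^ 2) =ᶠ[𝓝 0]
        fun t => (1 + s + t) ^ 2 * f y ^ 2 := by
      have : ∀ᶠ t : ℝ in 𝓝 0, -(1 + s) < t := eventually_gt_nhds (by linarith)
      filter_upwards [this] with t ht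
      exact key s t (by linarith)
    rw [e.deriv_eq]
    have h : HasDerivAt (fun t : ℝ => (1 + s + t) ^ 2 * f y ^ 2)
        (((2 : ℕ) : ℝ) * (1 + s + 0) ^ (2 - 1) * 1 * f y ^ 2) 0 :=
      (((hasDerivAt_id (0 : ℝ)).const_add (1 + s)).pow 2).mul_const _
    rw [h.deriv]
    norm_num
  have e : (fun s : ℝ => deriv (fun t : ℝ => f (y + s • y + t • y) ^ 2) 0) =ᶠ[𝓝 0]
      fun s => 2 * (1 + s) * f y ^ 2 := by
    have : ∀ᶠ s : ℝ in 𝓝 0, -1 < s := eventually_gt_nhds (by norm_num)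
    filter_upwards [this] with s hs
    exact h1 s (by linarith)
  have h : HasDerivAt (fun s : ℝ => 2 * (1 + s) * f y ^ 2) (2 * 1 * f y ^ 2) 0 :=
    (((hasDerivAt_id (0 : ℝ)).const_add 1).const_mul 2).mul_const _
  rw [fundamentalForm, e.deriv_eq, h.deriv]
  ring

namespace MinkowskiNorm

variable {V : Type*} [NormedAddCommGroup V] [NormedSpace ℝ V] (N : MinkowskiNorm V)

theorem pos {y : V} (hy : y ≠ 0) : 0 < N.toFun y := by
  have h := N.posDef y y hy hy
  rw [fundamentalForm_self _ N.homogeneous] at h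
  exact lt_of_le_of_ne (N.nonneg y) fun h0 => by simp [← h0] at h

theorem contDiffAt {y : V} (hy : y ≠ 0) : ContDiffAt ℝ ∞ N.toFun y :=
  N.smooth.contDiffAt (isOpen_compl_singleton.mem_nhds hy)

/-- The indicatrix (unit hypersurface) of a Minkowski norm. -/
def indicatrix : Set V := {y | N.toFun y = 1}

theorem ne_zero (y : N.indicatrix) : (y : V) ≠ 0 := by
  intro h
  have h1 : N.toFun (y : V) = 1 := y.2
  have h2 := N.homogeneous 2 0 two_pos
  rw [smul_zero] at h2
  rw [h] at h1
  linarith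

theorem smul_mem {v : V} (hv : v ≠ 0) : (N.toFun v)⁻¹ • v ∈ N.indicatrix := by
  change N.toFun _ = 1
  rw [N.homogeneous _ _ (inv_pos.2 (N.pos hv)), inv_mul_cancel₀ (N.pos hv).ne']

/-! ### The diffeomorphism group of the indicatrix -/

theorem smooth_comp {σ τ : N.indicatrix → N.indicatrix}
    (hσ : SmoothOnSubset N.indicatrix fun y => (σ y : V))
    (hτ : SmoothOnSubset N.indicatrix fun y => (τ y : V)) :
    SmoothOnSubset N.indicatrix fun y => (σ (τ y) : V) := by
  intro a
  obtain ⟨U, hU, haU, g, hg, hgf⟩ := hτ a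
  obtain ⟨U', hU', haU', g', hg', hgf'⟩ := hσ (τ a)
  refine ⟨U ∩ g ⁻¹' U', hg.continuousOn.isOpen_inter_preimage hU hU', ⟨haU, ?_⟩, g' ∘ g,
    hg'.comp (hg.mono inter_subset_left) fun x hx => hx.2, ?_⟩
  · change g a ∈ U'
    rw [hgf a haU]
    exact haU'
  · rintro b ⟨hb, hb'⟩
    change g b ∈ U' at hb'
    rw [hgf b hb] at hb'
    change g' (g b) = _
    rw [hgf b hb, hgf' _ hb']

/-- The group of `C^∞` diffeomorphisms of the indicatrix: the bijections that are smooth together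
with their inverse. -/
def diffGroup : Subgroup (Equiv.Perm N.indicatrix) where
  carrier := {σ | SmoothOnSubset N.indicatrix (fun y => (σ y : V)) ∧
    SmoothOnSubset N.indicatrix (fun y => (σ.symm y : V))}
  one_mem' := by
    have : SmoothOnSubset N.indicatrix (fun y => (y : V)) := fun a =>
      ⟨univ, isOpen_univ, mem_univ _, id, contDiffOn_id, fun _ _ => rfl⟩
    exact ⟨this, this⟩
  mul_mem' := by
    rintro σ τ ⟨h1, h2⟩ ⟨h3, h4⟩
    exact ⟨N.smooth_comp (σ := σ) (τ := τ) h1 h3, N.smooth_comp (σ := τ.symm) (τ := σ.symm) h4 h2⟩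
  inv_mem' := by
    rintro σ ⟨h1, h2⟩
    exact ⟨h2, h1⟩

/-! ### The Lie algebra of vector fields on the indicatrix -/

/-- Smooth vector fields on the indicatrix: smooth maps `X` with `X y` in the tangent
hyperplane `ker dN_y` of the indicatrix at `y`. -/
def vectorFields : Submodule ℝ (N.indicatrix → V) where
  carrier := {X | SmoothOnSubset N.indicatrix X ∧ ∀ y : N.indicatrix, fderiv ℝ N.toFun y (X y) = 0}
  zero_mem' := ⟨fun _ => ⟨univ, isOpen_univ, mem_univ _, fun _ => 0, contDiffOn_const,
    fun _ _ => rfl⟩, fun y => by simp⟩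
  add_mem' := by
    rintro X Y ⟨hX, hX'⟩ ⟨hY, hY'⟩
    refine ⟨fun a => ?_, fun y => ?_⟩
    · obtain ⟨U, hU, haU, g, hg, hgf⟩ := hX a
      obtain ⟨U', hU', haU', g', hg', hgf'⟩ := hY a
      refine ⟨U ∩ U', hU.inter hU', ⟨haU, haU'⟩, fun x => g x + g' x,
        (hg.mono inter_subset_left).add (hg'.mono inter_subset_right), fun b hb => ?_⟩
      simp [hgf b hb.1, hgf' b hb.2]
    · simp [hX' y, hY' y]
  smul_mem' := by
    rintro c X ⟨hX, hX'⟩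
    refine ⟨fun a => ?_, fun y => ?_⟩
    · obtain ⟨U, hU, haU, g, hg, hgf⟩ := hX a
      exact ⟨U, hU, haU, fun x => c • g x, hg.const_smul c, fun b hb => by simp [hgf b hb]⟩
    · simp [hX' y]

open Classical in
/-- The positively 1-homogeneous extension `v ↦ N(v) X(v / N(v))` to `V ∖ {0}` of a map on the
indicatrix (with value `0` at the origin). -/
def homExt (X : N.indicatrix → V) (v : V) : V :=
  if h : v ≠ 0 then N.toFun v • X ⟨(N.toFun v)⁻¹ • v, N.smul_mem h⟩ else 0

theorem homExt_apply (X : N.indicatrix → V) (y : N.indicatrix) : N.homExt X y = X y := by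
  have h1 : N.toFun (y : V) = 1 := y.2
  simp [homExt, N.ne_zero y, h1]

theorem homExt_smul (X : N.indicatrix → V) {c : ℝ} (hc : 0 < c) (v : V) :
    N.homExt X (c • v) = c • N.homExt X v := by
  by_cases hv : v = 0
  · simp [homExt, hv]
  · have hcv : c • v ≠ 0 := smul_ne_zero hc.ne' hv
    have e : (N.toFun (c • v))⁻¹ • c • v = (N.toFun v)⁻¹ • v := by
      rw [N.homogeneous c v hc, smul_smul, mul_inv, mul_comm c⁻¹, mul_assoc,
        inv_mul_cancel₀ hc.ne', mul_one]
    simp only [homExt, hv, hcv, ne_eq, not_false_eq_true, dite_true, e]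
    exact (congrArg (fun r : ℝ => r • X ⟨(N.toFun v)⁻¹ • v, N.smul_mem hv⟩)
      (N.homogeneous c v hc)).trans (mul_smul _ _ _)

theorem contDiffAt_homExt {X : N.indicatrix → V} (hX : SmoothOnSubset N.indicatrix X)
    {v : V} (hv : v ≠ 0) : ContDiffAt ℝ ∞ (N.homExt X) v := by
  obtain ⟨U, hU, haU, g, hg, hgf⟩ := hX ⟨(N.toFun v)⁻¹ • v, N.smul_mem hv⟩
  have hr : ContDiffAt ℝ ∞ (fun w => (N.toFun w)⁻¹ • w) v :=
    ((N.contDiffAt hv).inv (N.pos hv).ne').smul contDiffAt_id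
  have hgr : ContDiffAt ℝ ∞ (fun w => N.toFun w • g ((N.toFun w)⁻¹ • w)) v :=
    (N.contDiffAt hv).smul 
      (ContDiffAt.comp (g := g) (f := fun w => (N.toFun w)⁻¹ • w) v
        (hg.contDiffAt (hU.mem_nhds haU)) hr)
  refine hgr.congr_of_eventuallyEq ?_
  filter_upwards [isOpen_compl_singleton.mem_nhds hv,
    hr.continuousAt.preimage_mem_nhds (hU.mem_nhds haU)] with w hw hwU
  have hw' : w ≠ 0 := hw
  simp only [homExt, hw', ne_eq, not_false_eq_true, dite_true]
  rw [← hgf ⟨_, N.smul_mem hw'⟩ hwU]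

theorem fderiv_smul_of_homogeneous {f : V → V} (hf : ∀ (c : ℝ) (v : V), 0 < c → f (c • v) = c • f v)
    {c : ℝ} (hc : 0 < c) (v : V) : fderiv ℝ f (c • v) = fderiv ℝ f v := by
  have h1 : fderiv ℝ (fun x => f (c • x)) v = c • fderiv ℝ f (c • v) := fderiv_comp_smul c
  have h2 : (fun x => f (c • x)) = c • f := by
    ext x
    exact hf c x hc
  rw [h2, fderiv_const_smul_field] at h1
  exact (smul_right_injective _ hc.ne' h1).symm

/-- The Lie bracket of vector fields on the indicatrix, computed in the ambient vector space with
the homogeneous extensions: `[X, Y](y) = DY(y) X(y) - DX(y) Y(y)`. -/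
def bracketFun (X Y : N.indicatrix → V) (y : N.indicatrix) : V :=
  VectorField.lieBracket ℝ (N.homExt X) (N.homExt Y) y

theorem homExt_bracketFun (X Y : N.indicatrix → V) {v : V} (hv : v ≠ 0) :
    N.homExt (N.bracketFun X Y) v = VectorField.lieBracket ℝ (N.homExt X) (N.homExt Y) v := by
  have hp := N.pos hv
  have hp' := inv_pos.2 hp
  simp only [homExt, hv, ne_eq, not_false_eq_true, dite_true, bracketFun]
  change _ • VectorField.lieBracket ℝ (N.homExt X) (N.homExt Y) _ = _
  simp only [VectorField.lieBracket]
  rw [fderiv_smul_of_homogeneous (fun c v hc => N.homExt_smul X hc v) hp',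
    fderiv_smul_of_homogeneous (fun c v hc => N.homExt_smul Y hc v) hp',
    N.homExt_smul X hp', N.homExt_smul Y hp', map_smul, map_smul, ← smul_sub, smul_smul,
    mul_inv_cancel₀ hp.ne', one_smul]

theorem fderiv_homExt {X : N.indicatrix → V}
    (hX : ∀ y : N.indicatrix, fderiv ℝ N.toFun y (X y) = 0) {v : V} (hv : v ≠ 0) :
    fderiv ℝ N.toFun v (N.homExt X v) = 0 := by
  have hp' := inv_pos.2 (N.pos hv)
  have h1 : fderiv ℝ (fun x => N.toFun ((N.toFun v)⁻¹ • x)) v =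
      (N.toFun v)⁻¹ • fderiv ℝ N.toFun ((N.toFun v)⁻¹ • v) := fderiv_comp_smul _
  have h2 : (fun x => N.toFun ((N.toFun v)⁻¹ • x)) = (N.toFun v)⁻¹ • N.toFun := by
    ext x
    exact N.homogeneous _ x hp'
  rw [h2, fderiv_const_smul_field] at h1
  have h3 : fderiv ℝ N.toFun v = fderiv ℝ N.toFun ((N.toFun v)⁻¹ • v) :=
    smul_right_injective _ hp'.ne' h1
  have h4 := hX ⟨_, N.smul_mem hv⟩
  simp only [homExt, hv, ne_eq, not_false_eq_true, dite_true, map_smul]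
  rw [h3, h4, smul_zero]

theorem bracketFun_mem (X Y : N.vectorFields) : N.bracketFun X Y ∈ N.vectorFields := by
  have hX := X.2
  have hY := Y.2
  have sm : ∀ v : V, v ≠ 0 →
      ContDiffAt ℝ ∞ (VectorField.lieBracket ℝ (N.homExt X) (N.homExt Y)) v := fun v hv =>
    (N.contDiffAt_homExt hX.1 hv).lieBracket_vectorField (N.contDiffAt_homExt hY.1 hv) (by simp)
  refine ⟨fun a => ⟨{0}ᶜ, isOpen_compl_singleton, N.ne_zero a,
    VectorField.lieBracket ℝ (N.homExt X) (N.homExt Y),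
    fun v hv => (sm v hv).contDiffWithinAt, fun b _ => rfl⟩, fun y => ?_⟩
  have hy := N.ne_zero y
  have hz : ∀ Z : N.vectorFields,
      (fun x => fderiv ℝ N.toFun x (N.homExt Z x)) =ᶠ[𝓝 (y : V)] fun _ => 0 := by
    intro Z
    filter_upwards [isOpen_compl_singleton.mem_nhds hy] with w hw
    exact N.fderiv_homExt Z.2.2 hw
  have h := VectorField.fderiv_apply_lieBracket (𝕜 := ℝ) (n := 2) (f := N.toFun) (x := (y : V))
    (V := N.homExt X) (W := N.homExt Y) ((N.contDiffAt hy).of_le (WithTop.coe_le_coe.2 le_top)) (by simp)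
    ((N.contDiffAt_homExt hY.1 hy).differentiableAt (by simp))
    ((N.contDiffAt_homExt hX.1 hy).differentiableAt (by simp))
  change fderiv ℝ N.toFun y (VectorField.lieBracket ℝ (N.homExt X) (N.homExt Y) y) = 0
  rw [h, (hz X).fderiv_eq, (hz Y).fderiv_eq]
  simp

instance : Bracket N.vectorFields N.vectorFields :=
  ⟨fun X Y => ⟨N.bracketFun X Y, N.bracketFun_mem X Y⟩⟩

theorem homExt_add (X Y : N.indicatrix → V) : N.homExt (X + Y) = N.homExt X + N.homExt Y := by
  ext v
  by_cases hv : v = 0 <;> simp [homExt, hv]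

theorem homExt_const_smul (c : ℝ) (X : N.indicatrix → V) : N.homExt (c • X) = c • N.homExt X := by
  ext v
  by_cases hv : v = 0 <;> simp [homExt, hv, smul_comm c]

theorem differentiableAt_homExt (X : N.vectorFields) (y : N.indicatrix) :
    DifferentiableAt ℝ (N.homExt X) y :=
  (N.contDiffAt_homExt X.2.1 (N.ne_zero y)).differentiableAt (by simp)

instance : LieRing N.vectorFields where
  add_lie X Y Z := by
    refine Subtype.ext (funext fun y => ?_)
    change VectorField.lieBracket ℝ (N.homExt (X.1 + Y.1)) (N.homExt Z) y = _
    rw [homExt_add, VectorField.lieBracket_add_left (N.differentiableAt_homExt X y)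
      (N.differentiableAt_homExt Y y)]
    rfl
  lie_add X Y Z := by
    refine Subtype.ext (funext fun y => ?_)
    change VectorField.lieBracket ℝ (N.homExt X) (N.homExt (Y.1 + Z.1)) y = _
    rw [homExt_add, VectorField.lieBracket_add_right (N.differentiableAt_homExt Y y)
      (N.differentiableAt_homExt Z y)]
    rfl
  lie_self X := by
    refine Subtype.ext (funext fun y => ?_)
    change VectorField.lieBracket ℝ (N.homExt X) (N.homExt X) y = _
    simp
  leibniz_lie X Y Z := by
    refine Subtype.ext (funext fun y => ?_)
    have hy := N.ne_zero y
    have hz : ∀ A B : N.vectorFields, N.homExt (N.bracketFun A B) =ᶠ[𝓝 (y : V)]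
        VectorField.lieBracket ℝ (N.homExt A) (N.homExt B) := by
      intro A B
      filter_upwards [isOpen_compl_singleton.mem_nhds hy] with w hw
      exact N.homExt_bracketFun _ _ hw
    change VectorField.lieBracket ℝ (N.homExt X) (N.homExt (N.bracketFun Y Z)) y =
      VectorField.lieBracket ℝ (N.homExt (N.bracketFun X Y)) (N.homExt Z) y +
      VectorField.lieBracket ℝ (N.homExt Y) (N.homExt (N.bracketFun X Z)) y
    rw [EventuallyEq.rfl.lieBracket_vectorField_eq (hz Y Z),
      (hz X Y).lieBracket_vectorField_eq EventuallyEq.rfl,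
      EventuallyEq.rfl.lieBracket_vectorField_eq (hz X Z)]
    exact VectorField.leibniz_identity_lieBracket (n := ∞)
      (by simpa using (WithTop.coe_le_coe.2 le_top : ((2 : ℕ∞) : WithTop ℕ∞) ≤ ((⊤ : ℕ∞) : WithTop ℕ∞)))
      (N.contDiffAt_homExt X.2.1 hy) (N.contDiffAt_homExt Y.2.1 hy) (N.contDiffAt_homExt Z.2.1 hy)

instance : LieAlgebra ℝ N.vectorFields where
  lie_smul c X Y := by
    refine Subtype.ext (funext fun y => ?_)
    change VectorField.lieBracket ℝ (N.homExt X) (N.homExt (c • Y.1)) y = _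
    rw [homExt_const_smul, VectorField.lieBracket_const_smul_right (N.differentiableAt_homExt Y y)]
    rfl

/-- The bracket does not depend on the extensions: it can be computed with any differentiable
extensions of the two vector fields to a neighbourhood of the point. -/
theorem bracket_eq_of_extension (X Y : N.vectorFields) (y : N.indicatrix) {A B : V → V}
    (hA : DifferentiableAt ℝ A y) (hB : DifferentiableAt ℝ B y)
    (hAX : ∀ᶠ v in 𝓝 (y : V), ∀ h : v ∈ N.indicatrix, A v = X.1 ⟨v, h⟩)
    (hBY : ∀ᶠ v in 𝓝 (y : V), ∀ h : v ∈ N.indicatrix, B v = Y.1 ⟨v, h⟩) :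
    (⁅X, Y⁆ : N.vectorFields).1 y = VectorField.lieBracket ℝ A B y := by
  have hy := N.ne_zero y
  have hN1 : N.toFun (y : V) = 1 := y.2
  -- directional derivatives along tangent vectors depend on values on the indicatrix only
  have key : ∀ (Z W : N.vectorFields) (C : V → V), DifferentiableAt ℝ C y →
      (∀ᶠ v in 𝓝 (y : V), ∀ h : v ∈ N.indicatrix, C v = Z.1 ⟨v, h⟩) →
      fderiv ℝ (N.homExt Z) y (W.1 y) = fderiv ℝ C y (W.1 y) := by
    intro Z W C hC hCZ
    let γ : ℝ → V := fun t => (N.toFun (y + t • W.1 y))⁻¹ • ((y : V) + t • W.1 y)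
    have hl : HasDerivAt (fun t : ℝ => (y : V) + t • W.1 y) (W.1 y) 0 := by
      simpa using ((hasDerivAt_id (0 : ℝ)).smul_const (W.1 y)).const_add (y : V)
    have h0 : (y : V) + (0 : ℝ) • W.1 y = y := by simp
    have hNd : HasDerivAt (fun t : ℝ => N.toFun ((y : V) + t • W.1 y)) 0 0 := by
      have hd : HasFDerivAt N.toFun (fderiv ℝ N.toFun y) ((y : V) + (0 : ℝ) • W.1 y) := by
        rw [h0]
        exact ((N.contDiffAt hy).differentiableAt (by simp)).hasFDerivAt
      have h := hd.comp_hasDerivAt (0 : ℝ) hl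
      rw [W.2.2 y] at h
      exact h
    have hγ0 : γ 0 = y := by simp [γ, hN1]
    have hγ : HasDerivAt γ (W.1 y) 0 := by
      have hinv := hNd.inv (by rw [h0, hN1]; exact one_ne_zero)
      have h : HasDerivAt γ _ 0 := hinv.smul hl
      convert h using 1
      simp [hN1]
    have hγm : ∀ᶠ t in 𝓝 (0 : ℝ), γ t ∈ N.indicatrix := by
      have hc : ContinuousAt (fun t : ℝ => (y : V) + t • W.1 y) 0 := hl.continuousAt
      have : ∀ᶠ t in 𝓝 (0 : ℝ), (y : V) + t • W.1 y ∈ ({0}ᶜ : Set V) :=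
        hc.preimage_mem_nhds (isOpen_compl_singleton.mem_nhds (by rw [h0]; exact hy))
      filter_upwards [this] with t ht
      exact N.smul_mem ht
    have e : (fun t => N.homExt Z (γ t)) =ᶠ[𝓝 0] fun t => C (γ t) := by
      have : ∀ᶠ t in 𝓝 (0 : ℝ), ∀ h : γ t ∈ N.indicatrix, C (γ t) = Z.1 ⟨γ t, h⟩ := by
        have hc : Tendsto γ (𝓝 0) (𝓝 (y : V)) := by
          have := hγ.continuousAt.tendsto
          rwa [hγ0] at this
        exact hc.eventually hCZ
      filter_upwards [this, hγm] with t h1 h2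
      rw [h1 h2]
      exact N.homExt_apply Z.1 ⟨γ t, h2⟩
    have d1 : HasDerivAt (fun t => N.homExt Z (γ t)) (fderiv ℝ (N.homExt Z) y (W.1 y)) 0 := by
      have hd : HasFDerivAt (N.homExt Z) (fderiv ℝ (N.homExt Z) y) (γ 0) := by
        rw [hγ0]
        exact (N.differentiableAt_homExt Z y).hasFDerivAt
      exact hd.comp_hasDerivAt (0 : ℝ) hγ
    have d2 : HasDerivAt (fun t => C (γ t)) (fderiv ℝ C y (W.1 y)) 0 := by
      have hd : HasFDerivAt C (fderiv ℝ C y) (γ 0) := by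
        rw [hγ0]
        exact hC.hasFDerivAt
      exact hd.comp_hasDerivAt (0 : ℝ) hγ
    exact d1.unique (d2.congr_of_eventuallyEq e)
  have hAy : A y = X.1 y := hAX.self_of_nhds y.2
  have hBy : B y = Y.1 y := hBY.self_of_nhds y.2
  change VectorField.lieBracket ℝ (N.homExt X) (N.homExt Y) y = _
  simp only [VectorField.lieBracket, homExt_apply, hAy, hBy]
  rw [key Y X B hB hBY, key X Y A hA hAX]

/-! ### Tangent vector fields of a subgroup of the diffeomorphism group -/

/-- A `C^∞` curve `t ↦ φ t` in the diffeomorphism group of the indicatrix, for `t ∈ (-ε, ε)`: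
the map `(t, y) ↦ φ t y` is smooth. -/
def IsSmoothCurve (ε : ℝ) (φ : ℝ → N.diffGroup) : Prop :=
  SmoothOnSubset (Ioo (-ε) ε ×ˢ N.indicatrix)
    (fun q => ((φ q.1.1).1 ⟨q.1.2, q.2.2⟩ : V))

/-- `φ` is an integral curve of order `k` of the vector field `X`: `φ 0 = id` and, for every point
`y`, the curve `t ↦ φ t y` has vanishing derivatives of orders `1, …, k - 1` at `t = 0`, and its
`k`-th derivative at `t = 0` is `X y`. -/
def IsIntegralCurveOfOrder (k : ℕ) (φ : ℝ → N.diffGroup) (X : N.vectorFields) : Prop :=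
  φ 0 = 1 ∧ ∀ y : N.indicatrix,
    (∀ i : ℕ, 1 ≤ i → i < k → iteratedDeriv i (fun t => ((φ t).1 y : V)) 0 = 0) ∧
    iteratedDeriv k (fun t => ((φ t).1 y : V)) 0 = X.1 y

/-- The set of vector fields on the indicatrix that are tangent to the subgroup `G` of the
diffeomorphism group: those having an integral curve (of some order) in `G`. -/
def tangentSet (G : Subgroup N.diffGroup) : Set N.vectorFields :=
  {X | ∃ ε : ℝ, 0 < ε ∧ ∃ φ : ℝ → N.diffGroup, (∀ t ∈ Ioo (-ε) ε, φ t ∈ G) ∧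
    N.IsSmoothCurve ε φ ∧ ∃ k : ℕ, 1 ≤ k ∧ N.IsIntegralCurveOfOrder k φ X}

end MinkowskiNorm

/-! ### Finsler manifolds -/

/-- A Finsler metric on the `n`-dimensional smooth manifold `M`. -/
structure FinslerMetric (n : ℕ) (M : Type*) [TopologicalSpace M]
    [ChartedSpace (EuclideanSpace ℝ (Fin n)) M] [IsManifold (𝓡 n) ∞ M] where
  toFun : TangentBundle (𝓡 n) M → ℝ
  nonneg : ∀ v, 0 ≤ toFun v
  homogeneous : ∀ (x : M) (y : TangentSpace (𝓡 n) x) (c : ℝ), 0 < c →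
    toFun ⟨x, c • y⟩ = c * toFun ⟨x, y⟩
  continuous : Continuous toFun
  smooth : ContMDiffOn (𝓡 n).tangent 𝓘(ℝ, ℝ) ∞ toFun {v | v.2 ≠ 0}
  posDef : ∀ (x : M) (y u : TangentSpace (𝓡 n) x), y ≠ 0 → u ≠ 0 →
    0 < fundamentalForm (fun z : TangentSpace (𝓡 n) x => toFun ⟨x, z⟩) y u u

namespace FinslerMetric

variable {n : ℕ} {M : Type*} [TopologicalSpace M]
  [ChartedSpace (EuclideanSpace ℝ (Fin n)) M] [IsManifold (𝓡 n) ∞ M] (F : FinslerMetric n M)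

/-- The Minkowski norm `F_p` on `T_p M`, which as a vector space is `EuclideanSpace ℝ (Fin n)`. Its
indicatrix is the indicatrix `I_p` of the Finsler manifold at `p`. -/
def fiber (p : M) : MinkowskiNorm (EuclideanSpace ℝ (Fin n)) where
  toFun y := F.toFun ⟨p, y⟩
  nonneg y := F.nonneg _
  homogeneous c y hc := F.homogeneous p y c hc
  smooth := by
    have h : ContMDiff 𝓘(ℝ, EuclideanSpace ℝ (Fin n)) (𝓡 n).tangent ∞
        (fun y : EuclideanSpace ℝ (Fin n) => (⟨p, y⟩ : TangentBundle (𝓡 n) M)) := by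
      intro y
      rw [Bundle.contMDiffAt_totalSpace]
      refine ⟨contMDiffAt_const, ?_⟩
      have hL : ContDiff ℝ ∞ (fun z : EuclideanSpace ℝ (Fin n) =>
          (trivializationAt (EuclideanSpace ℝ (Fin n)) (TangentSpace (𝓡 n)) p).continuousLinearMapAt
            ℝ p z) :=
        ContinuousLinearMap.contDiff (𝕜 := ℝ) (E := EuclideanSpace ℝ (Fin n))
          (F := EuclideanSpace ℝ (Fin n))
          ((trivializationAt (EuclideanSpace ℝ (Fin n))
            (TangentSpace (𝓡 n) : M → Type _) p).continuousLinearMapAt ℝ p)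
      refine hL.contMDiff.contMDiffAt.congr_of_eventuallyEq (Eventually.of_forall fun z => ?_)
      exact (congrFun ((trivializationAt (EuclideanSpace ℝ (Fin n))
        (TangentSpace (𝓡 n) : M → Type _) p).coe_linearMapAt_of_mem (R := ℝ)
          (FiberBundle.mem_baseSet_trivializationAt' p)) z).symm
    exact (F.smooth.comp h.contMDiffOn fun y hy => hy).contDiffOn
  posDef y u hy hu := F.posDef p y u hy hu

/-! #### Local coordinates

For a chart `e` of `M`, `x ∈ e.target` and `y : EuclideanSpace ℝ (Fin n)`, the pair `(x, y)`
represents the tangent vector `y^i ∂/∂x^i` at the point with coordinates `x`. -/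

/-- The tangent vector `y^i ∂/∂x^i` at the point of `M` with coordinates `x` in the chart `e`. -/
def ofCoord (e : OpenPartialHomeomorph M (EuclideanSpace ℝ (Fin n)))
    (x y : EuclideanSpace ℝ (Fin n)) : TangentSpace (𝓡 n) (e.symm x) :=
  mfderiv (𝓡 n) (𝓡 n) e.symm x y

/-- The components of the tangent vector `v` in the chart `e`. -/
def coord (e : OpenPartialHomeomorph M (EuclideanSpace ℝ (Fin n)))
    (v : TangentBundle (𝓡 n) M) : EuclideanSpace ℝ (Fin n) :=
  mfderiv (𝓡 n) (𝓡 n) e v.proj v.2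

/-- The matrix `g_{ij}(x, y) = g_{x,y}(∂/∂x^i, ∂/∂x^j)` in the chart `e`. -/
def gMatrix (e : OpenPartialHomeomorph M (EuclideanSpace ℝ (Fin n)))
    (x y : EuclideanSpace ℝ (Fin n)) : Matrix (Fin n) (Fin n) ℝ :=
  Matrix.of fun i j =>
    fundamentalForm (fun z : TangentSpace (𝓡 n) (e.symm x) => F.toFun ⟨e.symm x, z⟩)
      (ofCoord e x y) (ofCoord e x (EuclideanSpace.single i 1))
      (ofCoord e x (EuclideanSpace.single j 1))

/-- `∂g_{ij}/∂x^k` in the chart `e`. -/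
def dgMatrix (e : OpenPartialHomeomorph M (EuclideanSpace ℝ (Fin n)))
    (x y : EuclideanSpace ℝ (Fin n)) (i j k : Fin n) : ℝ :=
  fderiv ℝ (fun x' => F.gMatrix e x' y i j) x (EuclideanSpace.single k 1)

/-- The geodesic coefficients
`G^i = (1/4) g^{il} (2 ∂g_{jl}/∂x^k - ∂g_{jk}/∂x^l) y^j y^k` in the chart `e`. -/
def geodesicCoeff (e : OpenPartialHomeomorph M (EuclideanSpace ℝ (Fin n)))
    (x y : EuclideanSpace ℝ (Fin n)) (i : Fin n) : ℝ :=
  (1 / 4) * ∑ l, ∑ j, ∑ k, (F.gMatrix e x y)⁻¹ i l *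
    (2 * F.dgMatrix e x y j l k - F.dgMatrix e x y j k l) * y j * y k

/-- The connection coefficients `G^i_j = ∂G^i/∂y^j` in the chart `e`. -/
def connectionCoeff (e : OpenPartialHomeomorph M (EuclideanSpace ℝ (Fin n)))
    (x y : EuclideanSpace ℝ (Fin n)) (i j : Fin n) : ℝ :=
  fderiv ℝ (fun y' => F.geodesicCoeff e x y' i) y (EuclideanSpace.single j 1)

/-! #### Parallel translation and holonomy -/

/-- A vector field along a piecewise `C^1` curve `c` defined on `[0, 1]`, given as the curve
`X : t ↦ (c(t), X(t))` in the tangent bundle, is parallel if it is continuous and, at all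
but finitely many times, satisfies `dX^i/dt + G^i_j(c, X) dc^j/dt = 0` in every chart. -/
def IsParallel (X : ℝ → TangentBundle (𝓡 n) M) : Prop :=
  ContinuousOn X (Icc 0 1) ∧ ∃ S : Finset ℝ, ∀ t ∈ Ioo (0 : ℝ) 1, t ∉ S →
    ∀ e ∈ IsManifold.maximalAtlas (𝓡 n) ∞ M, (X t).proj ∈ e.source → ∀ i : Fin n,
      HasDerivAt (fun s => coord e (X s) i)
        (-∑ j, F.connectionCoeff e (e (X t).proj) (coord e (X t)) i j *
          deriv (fun s => e (X s).proj j) t) t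

/-- A curve `c : [0, 1] → M` that is continuous and piecewise `C^1`. -/
def IsPiecewiseC1 (n : ℕ) {M : Type*} [TopologicalSpace M]
    [ChartedSpace (EuclideanSpace ℝ (Fin n)) M] (c : ℝ → M) : Prop :=
  ContinuousOn c (Icc 0 1) ∧ ∃ (m : ℕ) (τ : Fin (m + 1) → ℝ), StrictMono τ ∧ τ 0 = 0 ∧
    τ (Fin.last m) = 1 ∧ ∀ i : Fin m,
      ContMDiffOn 𝓘(ℝ, ℝ) (𝓡 n) 1 c (Icc (τ i.castSucc) (τ i.succ))

/-- `f` is the parallel translation `I_p → I_p` along the closed curve `c` based at `p`: for every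
`y ∈ I_p` there is a parallel vector field along `c` with initial value `y` and final
value `f y`. -/
def IsParallelTranslation (p : M) (c : ℝ → M)
    (f : (F.fiber p).indicatrix → (F.fiber p).indicatrix) : Prop :=
  ∀ y : (F.fiber p).indicatrix, ∃ X : ℝ → TangentBundle (𝓡 n) M,
    (∀ t ∈ Icc (0 : ℝ) 1, (X t).proj = c t) ∧ F.IsParallel X ∧
    X 0 = ⟨p, (y : EuclideanSpace ℝ (Fin n))⟩ ∧ X 1 = ⟨p, (f y : EuclideanSpace ℝ (Fin n))⟩

/-- The holonomy group `Hol_p(M)`: the subgroup of the diffeomorphism group of the indicatrix `I_p`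
generated by the parallel translations along piecewise `C^1` closed curves starting at `p`. -/
def holonomyGroup (p : M) : Subgroup (F.fiber p).diffGroup :=
  Subgroup.closure {φ | ∃ c : ℝ → M, IsPiecewiseC1 n c ∧ c 0 = p ∧ c 1 = p ∧
    F.IsParallelTranslation p c φ.1}

/-- The holonomy algebra at `p`: the set of vector fields on `I_p` tangent to the
holonomy group. -/
def holonomyAlgebra (p : M) : Set (F.fiber p).vectorFields :=
  (F.fiber p).tangentSet (F.holonomyGroup p)

end FinslerMetric

end

/-! ### Smooth dependence of integrals on parameters, and Hadamard's lemma -/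

section Hadamard

universe u

/-! The holonomy group matters only as a subgroup: for every subgroup `G` of the diffeomorphism
group of the indicatrix, the tangent vector fields form a Lie algebra. Let `φ_t = id + t^k X/k! +
...` and `ψ_t = id + t^l Y/l! + ...` be curves in `G`. Substituting `a t^m` for `t` multiplies the
order by `m` and rescales `X` by a positive multiple of `a^k` (`IsTangentOfOrder.reparam`),
inversion gives `-X` (`IsTangentOfOrder.neg`), and for curves of equal order the product gives `X +
Y` (`IsTangentOfOrder.add`). Reparametrization brings two curves to a common order. Inversion is
needed because `a^k` is never negative for even `k`.

For the bracket, the commutator `φ ψ (ψ φ)⁻¹` is again a curve in `G`. It has order `k + l` and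
leading coefficient `-[X, Y]/(k! l!)` (`IsTangentOfOrder.commutator`), and the constant is removed
by rescaling.

To make the expansions precise, diffeomorphisms of the indicatrix are extended by homogeneity to `V
∖ {0}`, an open set on which ordinary calculus applies. Hadamard's lemma, iterated `k` times, writes
`φ_t(w) = w + t^k R(t, w)` with `R` of class `C^1` and `R(0, ·) = X/k!`. Conversely, such an
expansion with a merely convergent remainder determines the derivatives at `t = 0`, once the curve
is known to be smooth. -/

/-- Compactness of `[0, 1]` makes the bound uniform in `s`; the constant serves as the dominating
function under the integral sign. -/
theorem exists_eventually_forall_norm_le {H E : Type*} [TopologicalSpace H] [NormedAddCommGroup E]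
    {F : ℝ × H → E} {x : H} (hF : ∀ s ∈ Icc (0 : ℝ) 1, ContinuousAt F (s, x)) :
    ∃ C, ∀ᶠ x' in 𝓝 x, ∀ s ∈ Icc (0 : ℝ) 1, ‖F (s, x')‖ ≤ C := by
  have hc : ContinuousOn (fun s : ℝ => F (s, x)) (Icc 0 1) := fun s hs =>
    ((hF s hs).comp (f := fun s : ℝ => (s, x)) (by fun_prop)).continuousWithinAt
  obtain ⟨C, hC⟩ := isCompact_Icc.exists_bound_of_continuousOn hc
  refine ⟨C + 1, isCompact_Icc.eventually_forall_of_forall_eventually fun s hs => ?_⟩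
  have h : ∀ᶠ q in 𝓝 (s, x), ‖F q‖ < C + 1 :=
    (hF s hs).norm.eventually_lt_const (by linarith [hC s hs])
  have h' : Tendsto (fun z : H × ℝ => (z.2, z.1)) (𝓝 (x, s)) (𝓝 (s, x)) :=
    (continuous_snd.prodMk continuous_fst).tendsto _
  exact (h'.eventually h).mono fun z hz => hz.le

theorem continuousAt_integral_unitInterval {H E : Type*} [TopologicalSpace H]
    [FirstCountableTopology H] [NormedAddCommGroup E] [NormedSpace ℝ E] {F : ℝ × H → E} {x : H}
    (hF : ∀ᶠ x' in 𝓝 x, ∀ s ∈ Icc (0 : ℝ) 1, ContinuousAt F (s, x')) :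
    ContinuousAt (fun x' => ∫ s in (0 : ℝ)..1, F (s, x')) x := by
  obtain ⟨C, hC⟩ := exists_eventually_forall_norm_le hF.self_of_nhds
  refine intervalIntegral.continuousAt_of_dominated_interval (bound := fun _ => C) ?_ ?_
    (by simp) ?_
  · filter_upwards [hF] with x' hx'
    refine ContinuousOn.aestronglyMeasurable (fun s hs => ?_) measurableSet_uIoc
    rw [uIoc_of_le zero_le_one] at hs
    exact ((hx' s (Ioc_subset_Icc_self hs)).comp (f := fun s : ℝ => (s, x'))
      (by fun_prop)).continuousWithinAt
  · filter_upwards [hC] with x' hx'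
    refine Eventually.of_forall fun s hs => ?_
    rw [uIoc_of_le zero_le_one] at hs
    exact hx' s (Ioc_subset_Icc_self hs)
  · refine Eventually.of_forall fun s hs => ?_
    rw [uIoc_of_le zero_le_one] at hs
    exact (hF.self_of_nhds s (Ioc_subset_Icc_self hs)).comp (f := fun x' : H => (s, x'))
      (by fun_prop)

theorem hasFDerivAt_integral_unitInterval {H E : Type*} [NormedAddCommGroup H] [NormedSpace ℝ H]
    [NormedAddCommGroup E] [NormedSpace ℝ E] {F : ℝ × H → E} {x : H}
    (hF : ∀ s ∈ Icc (0 : ℝ) 1, ContDiffAt ℝ 1 F (s, x)) :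
    HasFDerivAt (fun x' => ∫ s in (0 : ℝ)..1, F (s, x'))
      (∫ s in (0 : ℝ)..1, (fderiv ℝ F (s, x)).comp (ContinuousLinearMap.inr ℝ ℝ H)) x := by
  have hev : ∀ᶠ x' in 𝓝 x, ∀ s ∈ Icc (0 : ℝ) 1, ContDiffAt ℝ 1 F (s, x') := by
    refine isCompact_Icc.eventually_forall_of_forall_eventually fun s hs => ?_
    have h' : Tendsto (fun z : H × ℝ => (z.2, z.1)) (𝓝 (x, s)) (𝓝 (s, x)) :=
      (continuous_snd.prodMk continuous_fst).tendsto _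
    exact h'.eventually ((hF s hs).eventually (by simp))
  let F' : ℝ × H → H →L[ℝ] E := fun q => (fderiv ℝ F q).comp (ContinuousLinearMap.inr ℝ ℝ H)
  have hF'c : ∀ s ∈ Icc (0 : ℝ) 1, ContinuousAt F' (s, x) := fun s hs =>
    (((hF s hs).fderiv_right (m := 0) le_rfl).continuousAt).clm_comp continuousAt_const
  obtain ⟨C, hC⟩ := exists_eventually_forall_norm_le hF'c
  have meas : ∀ᶠ x' in 𝓝 x, ContinuousOn (fun s => F (s, x')) (Icc (0 : ℝ) 1) := by
    filter_upwards [hev] with x' hx' s hs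
    exact ((hx' s hs).continuousAt.comp (f := fun s : ℝ => (s, x'))
      (by fun_prop)).continuousWithinAt
  refine intervalIntegral.hasFDerivAt_integral_of_dominated_of_fderiv_le (bound := fun _ => C)
    (F := fun x' s => F (s, x')) (F' := fun x' s => F' (s, x')) (hev.and hC) ?_ ?_ ?_ ?_ (by simp) ?_
  · filter_upwards [meas] with x' hx'
    refine ContinuousOn.aestronglyMeasurable ?_ measurableSet_uIoc
    rw [uIoc_of_le zero_le_one]
    exact hx'.mono Ioc_subset_Icc_self
  · refine ContinuousOn.intervalIntegrable ?_
    rw [uIcc_of_le zero_le_one]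
    exact meas.self_of_nhds
  · refine ContinuousOn.aestronglyMeasurable (fun s hs => ?_) measurableSet_uIoc
    rw [uIoc_of_le zero_le_one] at hs
    exact ((hF'c s (Ioc_subset_Icc_self hs)).comp (f := fun s : ℝ => (s, x))
      (by fun_prop)).continuousWithinAt
  · refine Eventually.of_forall fun s hs x' hx' => ?_
    rw [uIoc_of_le zero_le_one] at hs
    exact hx'.2 s (Ioc_subset_Icc_self hs)
  · refine Eventually.of_forall fun s hs x' hx' => ?_
    rw [uIoc_of_le zero_le_one] at hs
    have h1 : HasFDerivAt F (fderiv ℝ F (s, x')) (s, x') :=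
      ((hx'.1 s (Ioc_subset_Icc_self hs)).differentiableAt one_ne_zero).hasFDerivAt
    exact h1.comp x' (hasFDerivAt_prodMk_right s x')

/-- Induction on `n` by differentiating under the integral. The derivative takes values in `H →L[ℝ]
E`, so `E` is quantified inside the induction and shares the universe of `H`. The order is finite
because being `C^n` at a point then extends to a neighbourhood. -/
theorem contDiffAt_integral_unitInterval {H : Type u} [NormedAddCommGroup H] [NormedSpace ℝ H]
    (n : ℕ) : ∀ {E : Type u} [NormedAddCommGroup E] [NormedSpace ℝ E] {F : ℝ × H → E} {x : H},
    (∀ s ∈ Icc (0 : ℝ) 1, ContDiffAt ℝ n F (s, x)) →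
    ContDiffAt ℝ n (fun x' => ∫ s in (0 : ℝ)..1, F (s, x')) x := by
  have tube : ∀ {E : Type u} [NormedAddCommGroup E] [NormedSpace ℝ E] {F : ℝ × H → E} {x : H}
      (m : ℕ), (∀ s ∈ Icc (0 : ℝ) 1, ContDiffAt ℝ m F (s, x)) →
      ∀ᶠ x' in 𝓝 x, ∀ s ∈ Icc (0 : ℝ) 1, ContDiffAt ℝ m F (s, x') := by
    intro E _ _ F x m hF
    refine isCompact_Icc.eventually_forall_of_forall_eventually fun s hs => ?_
    have h' : Tendsto (fun z : H × ℝ => (z.2, z.1)) (𝓝 (x, s)) (𝓝 (s, x)) :=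
      (continuous_snd.prodMk continuous_fst).tendsto _
    exact h'.eventually ((hF s hs).eventually (by simp))
  induction n with
  | zero =>
    intro E _ _ F x hF
    have h1 := eventually_eventually_nhds.2 (tube 0 hF)
    refine contDiffAt_zero.2 ⟨_, h1, fun x' hx' => ContinuousAt.continuousWithinAt ?_⟩
    refine continuousAt_integral_unitInterval ?_
    have hx'' : ∀ᶠ y in 𝓝 x', ∀ s ∈ Icc (0 : ℝ) 1, ContDiffAt ℝ (0 : ℕ) F (s, y) := hx'
    exact hx''.mono fun y hy s hs => (hy s hs).continuousAt
  | succ n ih =>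
    intro E _ _ F x hF
    refine contDiffAt_succ_iff_hasFDerivAt.2 ⟨fun x' => ∫ s in (0 : ℝ)..1,
      (fderiv ℝ F (s, x')).comp (ContinuousLinearMap.inr ℝ ℝ H), ⟨_, tube (n + 1) hF,
      fun x' hx' => hasFDerivAt_integral_unitInterval fun s hs => (hx' s hs).of_le (by simp)⟩, ?_⟩
    exact ih (F := fun q => (fderiv ℝ F q).comp (ContinuousLinearMap.inr ℝ ℝ H)) fun s hs =>
      ((hF s hs).fderiv_right (m := n) (by simp)).clm_comp contDiffAt_const

/-- Hadamard's lemma in the first variable. -/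
theorem ContDiffAt.exists_eq_add_smul {V : Type u} [NormedAddCommGroup V] [NormedSpace ℝ V]
    [CompleteSpace V] {n : ℕ} {f : ℝ × V → V} {v : V} (hf : ContDiffAt ℝ (n + 1 : ℕ) f (0, v)) :
    ∃ g : ℝ × V → V, ContDiffAt ℝ n g (0, v) ∧
      ∀ᶠ q in 𝓝 ((0 : ℝ), v), f q = f (0, q.2) + q.1 • g q := by
  -- The integrand is `∂_t f(s t, w)`, since `f(t, w) - f(0, w) = t ∫₀¹ ∂_t f(s t, w) ds`.
  let F : ℝ × (ℝ × V) → V := fun z => fderiv ℝ f (z.1 * z.2.1, z.2.2) (1, 0)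
  refine ⟨fun q => ∫ s in (0 : ℝ)..1, F (s, q), contDiffAt_integral_unitInterval n fun s _ => ?_, ?_⟩
  · have hf' : ContDiffAt ℝ n (fderiv ℝ f) (s * (0 : ℝ), v) := by
      rw [mul_zero]
      exact hf.fderiv_right (m := n) (by simp)
    have hm : ContDiffAt ℝ n (fun z : ℝ × (ℝ × V) => (z.1 * z.2.1, z.2.2)) (s, (0, v)) := by
      fun_prop
    exact (ContDiffAt.comp (s, ((0 : ℝ), v)) hf' hm).clm_apply contDiffAt_const
  · have h1 : ContDiffAt ℝ 1 f (0, v) := hf.of_le (by simp)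
    obtain ⟨r, hr, hball⟩ := Metric.eventually_nhds_iff_ball.1 (h1.eventually (by simp))
    refine Metric.eventually_nhds_iff_ball.2 ⟨r, hr, fun q hq => ?_⟩
    have hq' : ∀ s ∈ Icc (0 : ℝ) 1, (s * q.1, q.2) ∈ Metric.ball ((0 : ℝ), v) r := by
      intro s hs
      rw [Metric.mem_ball, Prod.dist_eq, max_lt_iff] at hq ⊢
      refine ⟨lt_of_le_of_lt ?_ hq.1, hq.2⟩
      simp only [dist_zero_right, norm_mul, Real.norm_eq_abs, abs_of_nonneg hs.1]
      exact mul_le_of_le_one_left (abs_nonneg _) hs.2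
    have hd : ∀ s ∈ uIcc (0 : ℝ) 1, HasDerivAt (fun s : ℝ => f (s * q.1, q.2))
        (q.1 • F (s, q)) s := by
      intro s hs
      rw [uIcc_of_le zero_le_one] at hs
      have h2 : HasFDerivAt f (fderiv ℝ f (s * q.1, q.2)) (s * q.1, q.2) :=
        ((hball _ (hq' s hs)).differentiableAt one_ne_zero).hasFDerivAt
      have h3 : HasDerivAt (fun s : ℝ => (s * q.1, q.2)) (q.1 • ((1 : ℝ), (0 : V))) s := by
        simpa using ((hasDerivAt_id s).mul_const q.1).prodMk (hasDerivAt_const s q.2)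
      have h4 := h2.comp_hasDerivAt s h3
      rw [map_smul] at h4
      exact h4
    have hc : ContinuousOn (fun s : ℝ => q.1 • F (s, q)) (uIcc 0 1) := by
      intro s hs
      rw [uIcc_of_le zero_le_one] at hs
      have h2 : ContinuousAt (fderiv ℝ f) (s * q.1, q.2) :=
        ((hball _ (hq' s hs)).fderiv_right (m := 0) le_rfl).continuousAt
      have h3 : ContinuousAt (fun s : ℝ => fderiv ℝ f (s * q.1, q.2)) s :=
        ContinuousAt.comp (f := fun s : ℝ => (s * q.1, q.2)) h2 (by fun_prop)
      exact ((h3.clm_apply continuousAt_const).const_smul q.1).continuousWithinAt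
    have h4 := intervalIntegral.integral_eq_sub_of_hasDerivAt hd hc.intervalIntegrable
    rw [intervalIntegral.integral_smul] at h4
    simp only [one_mul, zero_mul] at h4
    change f q = f (0, q.2) + q.1 • ∫ s in (0 : ℝ)..1, F (s, q)
    rw [h4]
    abel

/-! ### Order of vanishing and leading coefficients. -/

theorem tendsto_inv_pow_smul_of_iteratedDeriv_eq_zero {V : Type*} [NormedAddCommGroup V]
    [NormedSpace ℝ V] {h : ℝ → V} {m : ℕ} (hh : ContDiffAt ℝ m h 0)
    (h0 : ∀ j < m, iteratedDeriv j h 0 = 0) :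
    Tendsto (fun t : ℝ => (t ^ m)⁻¹ • h t) (𝓝[≠] 0)
      (𝓝 ((m.factorial : ℝ)⁻¹ • iteratedDeriv m h 0)) := by
  obtain ⟨r, hr, hball⟩ := Metric.eventually_nhds_iff_ball.1 (hh.eventually (by simp))
  have hcd : ContDiffOn ℝ m h (Metric.ball 0 r) := fun t ht => (hball t ht).contDiffWithinAt
  have hmem := Metric.mem_ball_self (x := (0 : ℝ)) hr
  have key := taylor_tendsto (convex_ball (0 : ℝ) r) hmem hcd
  rw [Metric.isOpen_ball.nhdsWithin_eq hmem] at key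
  have hpoly : ∀ t : ℝ, taylorWithinEval h m (Metric.ball 0 r) 0 t =
      t ^ m • (m.factorial : ℝ)⁻¹ • iteratedDeriv m h 0 := by
    intro t
    rw [taylor_within_apply, Finset.sum_range_succ, Finset.sum_eq_zero, zero_add,
      iteratedDerivWithin_of_isOpen Metric.isOpen_ball hmem, sub_zero, mul_comm, mul_smul]
    intro j hj
    rw [iteratedDerivWithin_of_isOpen Metric.isOpen_ball hmem, h0 j (Finset.mem_range.1 hj),
      smul_zero]
  have key' := (key.mono_left (nhdsWithin_le_nhds (s := {0}ᶜ))).add_const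
    ((m.factorial : ℝ)⁻¹ • iteratedDeriv m h 0)
  rw [zero_add] at key'
  refine key'.congr' ?_
  filter_upwards [self_mem_nhdsWithin] with t ht
  rw [hpoly, sub_zero, smul_sub, inv_smul_smul₀ (pow_ne_zero m ht), sub_add_cancel]

/-- Once the derivatives below order `j < m` vanish, the `j`-th one is `j!` times the limit of `h t
/ t^j = t^(m-j) T t`, which is zero. `T` needs only a limit, because the smoothness of `h` is
assumed. -/
theorem iteratedDeriv_of_eventually_eq_pow_smul {V : Type*} [NormedAddCommGroup V]
    [NormedSpace ℝ V] {h T : ℝ → V} {T₀ : V} {m : ℕ} (hh : ContDiffAt ℝ m h 0)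
    (hT : Tendsto T (𝓝[≠] 0) (𝓝 T₀)) (e : ∀ᶠ t in 𝓝[≠] 0, h t = t ^ m • T t) :
    (∀ j < m, iteratedDeriv j h 0 = 0) ∧ iteratedDeriv m h 0 = (m.factorial : ℝ) • T₀ := by
  have hfac : ∀ j : ℕ, (j.factorial : ℝ) ≠ 0 := fun j => by exact_mod_cast j.factorial_ne_zero
  have low : ∀ j < m, iteratedDeriv j h 0 = 0 := by
    intro j
    induction j using Nat.strong_induction_on with
    | _ j ih =>
      intro hj
      have h1 := tendsto_inv_pow_smul_of_iteratedDeriv_eq_zero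
        (hh.of_le (by exact_mod_cast hj.le)) fun i hi => ih i hi (hi.trans hj)
      have h2 : Tendsto (fun t : ℝ => t ^ (m - j) • T t) (𝓝[≠] 0) (𝓝 ((0 : ℝ) ^ (m - j) • T₀)) :=
        (((continuous_pow (m - j)).tendsto (0 : ℝ)).mono_left nhdsWithin_le_nhds).smul hT
      rw [zero_pow (by omega), zero_smul] at h2
      have h3 := tendsto_nhds_unique (h1.congr' ?_) h2
      · exact (smul_eq_zero.1 h3).resolve_left (inv_ne_zero (hfac j))
      · filter_upwards [e, self_mem_nhdsWithin] with t ht ht0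
        rw [ht, ← Nat.sub_add_cancel hj.le, pow_add, mul_comm, mul_smul,
          inv_smul_smul₀ (pow_ne_zero j ht0), Nat.sub_add_cancel hj.le]
  refine ⟨low, ?_⟩
  have h1 := tendsto_inv_pow_smul_of_iteratedDeriv_eq_zero hh low
  have h3 := tendsto_nhds_unique (h1.congr' ?_) hT
  · rw [← h3, smul_inv_smul₀ (hfac m)]
  · filter_upwards [e, self_mem_nhdsWithin] with t ht ht0
    rw [ht, inv_smul_smul₀ (pow_ne_zero m ht0)]

/-- Hadamard's lemma is applied `k` times, each application costing one derivative. The quotient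
after `m < k` steps vanishes at `t = 0`, because its value there is the `m`-th derivative of `f`
divided by `m!`; this permits the next division. -/
theorem ContDiffAt.exists_eq_pow_smul {V : Type u} [NormedAddCommGroup V] [NormedSpace ℝ V]
    [CompleteSpace V] {n k : ℕ} {f : ℝ × V → V} {v : V} (hf : ContDiffAt ℝ (n + k : ℕ) f (0, v))
    (h0 : ∀ᶠ w in 𝓝 v, ∀ j < k, iteratedDeriv j (fun t => f (t, w)) 0 = 0) :
    ∃ g : ℝ × V → V, ContDiffAt ℝ n g (0, v) ∧ (∀ᶠ q in 𝓝 ((0 : ℝ), v), f q = q.1 ^ k • g q) ∧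
      ∀ᶠ w in 𝓝 v, g (0, w) = (k.factorial : ℝ)⁻¹ • iteratedDeriv k (fun t => f (t, w)) 0 := by
  have value : ∀ (m : ℕ) (g : ℝ × V → V), m ≤ k → ContDiffAt ℝ (n + k - m : ℕ) g (0, v) →
      (∀ᶠ q in 𝓝 ((0 : ℝ), v), f q = q.1 ^ m • g q) →
      ∀ᶠ w in 𝓝 v, g (0, w) = (m.factorial : ℝ)⁻¹ • iteratedDeriv m (fun t => f (t, w)) 0 := by
    intro m g hm hg hfg
    have hc : Tendsto (fun w : V => ((0 : ℝ), w)) (𝓝 v) (𝓝 (0, v)) :=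
      (by fun_prop : Continuous fun w : V => ((0 : ℝ), w)).tendsto v
    filter_upwards [h0, hc.eventually (hf.eventually (by simp [-Nat.cast_add])),
      hc.eventually (hg.eventually (by simp)), hc.eventually (eventually_eventually_nhds.2 hfg)]
      with w hw1 hw2 hw3 hw4
    have hs : Tendsto (fun t : ℝ => (t, w)) (𝓝 0) (𝓝 (0, w)) :=
      (by fun_prop : Continuous fun t : ℝ => (t, w)).tendsto 0
    have hfw : ContDiffAt ℝ m (fun t => f (t, w)) 0 :=
      (hw2.of_le (by exact_mod_cast hm.trans (Nat.le_add_left _ _))).comp (f := fun t : ℝ => (t, w))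
        0 (by fun_prop)
    have h1 := tendsto_inv_pow_smul_of_iteratedDeriv_eq_zero hfw fun j hj => hw1 j (hj.trans_le hm)
    have h2 : Tendsto (fun t => g (t, w)) (𝓝[≠] 0) (𝓝 (g (0, w))) :=
      (hw3.continuousAt.tendsto.comp hs).mono_left nhdsWithin_le_nhds
    refine tendsto_nhds_unique (h2.congr' ?_) h1
    filter_upwards [nhdsWithin_le_nhds (hs.eventually hw4), self_mem_nhdsWithin] with t ht ht0
    rw [ht, inv_smul_smul₀ (pow_ne_zero m ht0)]
  have step : ∀ m : ℕ, m ≤ k → ∃ g : ℝ × V → V, ContDiffAt ℝ (n + k - m : ℕ) g (0, v) ∧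
      ∀ᶠ q in 𝓝 ((0 : ℝ), v), f q = q.1 ^ m • g q := by
    intro m
    induction m with
    | zero => exact fun _ => ⟨f, hf, by simp⟩
    | succ m ih =>
      intro hm
      obtain ⟨g, hg, hfg⟩ := ih (by omega)
      have hg0 := value m g (by omega) hg hfg
      have hg' : ContDiffAt ℝ (n + k - (m + 1) + 1 : ℕ) g (0, v) := by
        convert hg using 2
        omega
      obtain ⟨g', hg', hgg'⟩ := hg'.exists_eq_add_smul
      refine ⟨g', hg', ?_⟩
      have hc : Tendsto (fun q : ℝ × V => q.2) (𝓝 ((0 : ℝ), v)) (𝓝 v) := continuous_snd.tendsto _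
      filter_upwards [hfg, hgg', hc.eventually hg0, hc.eventually h0] with q h1 h2 h3 h4
      rw [h1, h2, h3, h4 m (by omega), smul_zero, zero_add, pow_succ, mul_smul]
  obtain ⟨g, hg, hfg⟩ := step k le_rfl
  exact ⟨g, by simpa using hg, hfg, value k g le_rfl hg hfg⟩

end Hadamard

/-! ### Curves of diffeomorphisms of the indicatrix, extended by homogeneity -/

namespace MinkowskiNorm

section Flow

variable {V : Type*} [NormedAddCommGroup V] [NormedSpace ℝ V] (N : MinkowskiNorm V)

/-- The family of positively homogeneous bijections of `V ∖ {0}` extending a family of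
diffeomorphisms of the indicatrix. -/
noncomputable def flow (φ : ℝ → N.diffGroup) (q : ℝ × V) : V :=
  N.homExt (fun y => ((φ q.1).1 y : V)) q.2

variable {N}

theorem flow_coe (φ : ℝ → N.diffGroup) (t : ℝ) (y : N.indicatrix) :
    N.flow φ (t, y) = (φ t).1 y :=
  N.homExt_apply _ y

theorem homExt_of_ne_zero (X : N.indicatrix → V) {v : V} (hv : v ≠ 0) :
    N.homExt X v = N.toFun v • X ⟨_, N.smul_mem hv⟩ := by
  simp [homExt, hv]

theorem flow_of_ne_zero (φ : ℝ → N.diffGroup) (t : ℝ) {v : V} (hv : v ≠ 0) :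
    N.flow φ (t, v) = N.toFun v • ((φ t).1 ⟨_, N.smul_mem hv⟩ : V) :=
  homExt_of_ne_zero _ hv

theorem flow_ne_zero (φ : ℝ → N.diffGroup) {q : ℝ × V} (hq : q.2 ≠ 0) : N.flow φ q ≠ 0 := by
  obtain ⟨t, v⟩ := q
  rw [flow_of_ne_zero φ t hq]
  exact smul_ne_zero (N.pos hq).ne' (N.ne_zero _)

theorem flow_mul (φ ψ : ℝ → N.diffGroup) {q : ℝ × V} (hq : q.2 ≠ 0) :
    N.flow (φ * ψ) q = N.flow φ (q.1, N.flow ψ q) := by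
  obtain ⟨t, v⟩ := q
  rw [flow_of_ne_zero _ t hq, flow_of_ne_zero ψ t hq]
  exact ((N.homExt_smul _ (N.pos hq) _).trans (congrArg _ (flow_coe φ t _))).symm

theorem flow_of_eq_one {φ : ℝ → N.diffGroup} {q : ℝ × V} (h : φ q.1 = 1) (hq : q.2 ≠ 0) :
    N.flow φ q = q.2 := by
  obtain ⟨t, v⟩ := q
  rw [flow_of_ne_zero _ t hq, show φ t = 1 from h]
  exact smul_inv_smul₀ (N.pos hq).ne' v

theorem flow_flow_inv (φ : ℝ → N.diffGroup) {q : ℝ × V} (hq : q.2 ≠ 0) :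
    N.flow φ (q.1, N.flow φ⁻¹ q) = q.2 := by
  rw [← flow_mul _ _ hq, flow_of_eq_one (by simp) hq]

theorem flow_inv_flow (φ : ℝ → N.diffGroup) {q : ℝ × V} (hq : q.2 ≠ 0) :
    N.flow φ⁻¹ (q.1, N.flow φ q) = q.2 := by
  rw [← flow_mul _ _ hq, flow_of_eq_one (by simp) hq]

/-- Composition with the smooth retraction `v ↦ v / N(v)` turns local extensions into smoothness of
the homogeneous extension, so composites and inverses can be handled on an open set. -/
theorem isSmoothCurve_iff {ε : ℝ} {φ : ℝ → N.diffGroup} :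
    N.IsSmoothCurve ε φ ↔ ContDiffOn ℝ ∞ (N.flow φ) (Ioo (-ε) ε ×ˢ {0}ᶜ) := by
  constructor
  · rintro h ⟨t, v⟩ ⟨ht, hv⟩
    have hv' : v ≠ 0 := hv
    obtain ⟨U, hU, haU, g, hg, hgf⟩ := h ⟨(t, (N.toFun v)⁻¹ • v), ht, N.smul_mem hv'⟩
    have hN : ContDiffAt ℝ ∞ (fun q : ℝ × V => N.toFun q.2) (t, v) :=
      ContDiffAt.comp (t, v) (N.contDiffAt hv') contDiffAt_snd
    have hr : ContDiffAt ℝ ∞ (fun q : ℝ × V => (q.1, (N.toFun q.2)⁻¹ • q.2)) (t, v) :=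
      contDiffAt_fst.prodMk ((hN.inv (N.pos hv').ne').smul contDiffAt_snd)
    have hgr : ContDiffAt ℝ ∞ (fun q : ℝ × V => N.toFun q.2 • g (q.1, (N.toFun q.2)⁻¹ • q.2))
        (t, v) :=
      hN.smul (ContDiffAt.comp (g := g) (f := fun q : ℝ × V => (q.1, (N.toFun q.2)⁻¹ • q.2)) (t, v)
        (hg.contDiffAt (hU.mem_nhds haU)) hr)
    refine (hgr.congr_of_eventuallyEq ?_).contDiffWithinAt
    filter_upwards [(isOpen_Ioo.prod isOpen_compl_singleton).mem_nhds (⟨ht, hv⟩ : (t, v) ∈ Ioo (-ε) ε ×ˢ ({0}ᶜ : Set V)),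
      hr.continuousAt.preimage_mem_nhds (hU.mem_nhds haU)] with q hq hqU
    rw [hgf ⟨(q.1, (N.toFun q.2)⁻¹ • q.2), hq.1, N.smul_mem hq.2⟩ hqU]
    exact flow_of_ne_zero φ q.1 hq.2
  · rintro h ⟨⟨t, v⟩, ht, hv⟩
    exact ⟨_, isOpen_Ioo.prod isOpen_compl_singleton, ⟨ht, N.ne_zero ⟨v, hv⟩⟩, N.flow φ, h, fun b _ =>
      flow_coe φ b.1.1 ⟨b.1.2, b.2.2⟩⟩

theorem IsSmoothCurve.contDiffAt {ε : ℝ} {φ : ℝ → N.diffGroup} (h : N.IsSmoothCurve ε φ)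
    {q : ℝ × V} (ht : q.1 ∈ Ioo (-ε) ε) (hq : q.2 ≠ 0) : ContDiffAt ℝ ∞ (N.flow φ) q :=
  (isSmoothCurve_iff.1 h).contDiffAt ((isOpen_Ioo.prod isOpen_compl_singleton).mem_nhds ⟨ht, hq⟩)

theorem isSmoothCurve_of_contDiffAt {ε : ℝ} {φ : ℝ → N.diffGroup}
    (h : ∀ q : ℝ × V, q.1 ∈ Ioo (-ε) ε → q.2 ≠ 0 → ContDiffAt ℝ ∞ (N.flow φ) q) :
    N.IsSmoothCurve ε φ :=
  isSmoothCurve_iff.2 fun q hq => (h q hq.1 hq.2).contDiffWithinAt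

theorem isSmoothCurve_one (ε : ℝ) : N.IsSmoothCurve ε 1 := by
  refine isSmoothCurve_of_contDiffAt fun q _ hq => contDiffAt_snd.congr_of_eventuallyEq ?_
  filter_upwards [continuous_snd.continuousAt.preimage_mem_nhds
    (isOpen_compl_singleton.mem_nhds hq)] with z hz
  exact flow_of_eq_one rfl hz

theorem IsSmoothCurve.mono {ε δ : ℝ} {φ : ℝ → N.diffGroup} (h : N.IsSmoothCurve ε φ)
    (hδ : δ ≤ ε) : N.IsSmoothCurve δ φ :=
  isSmoothCurve_of_contDiffAt fun _ hq hq' => h.contDiffAt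
    ⟨by linarith [hq.1], by linarith [hq.2]⟩ hq'

theorem IsSmoothCurve.reparam {ε δ : ℝ} {φ : ℝ → N.diffGroup} (h : N.IsSmoothCurve ε φ)
    {σ : ℝ → ℝ} (hσ : ContDiff ℝ ∞ σ) (hσ' : MapsTo σ (Ioo (-δ) δ) (Ioo (-ε) ε)) :
    N.IsSmoothCurve δ (φ ∘ σ) :=
  isSmoothCurve_of_contDiffAt fun q hq hq' =>
    ContDiffAt.comp (g := N.flow φ) (f := fun q : ℝ × V => (σ q.1, q.2)) q
      (h.contDiffAt (hσ' hq) hq') (hσ.contDiffAt.fst'.prodMk contDiffAt_snd)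

theorem IsSmoothCurve.mul {ε : ℝ} {φ ψ : ℝ → N.diffGroup} (hφ : N.IsSmoothCurve ε φ)
    (hψ : N.IsSmoothCurve ε ψ) : N.IsSmoothCurve ε (φ * ψ) := by
  refine isSmoothCurve_of_contDiffAt fun q hq hq' => ?_
  have h : ContDiffAt ℝ ∞ (fun z : ℝ × V => N.flow φ (z.1, N.flow ψ z)) q :=
    ContDiffAt.comp (g := N.flow φ) (f := fun z : ℝ × V => (z.1, N.flow ψ z)) q
      (hφ.contDiffAt hq (flow_ne_zero ψ hq')) (contDiffAt_fst.prodMk (hψ.contDiffAt hq hq'))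
  refine h.congr_of_eventuallyEq ?_
  filter_upwards [continuous_snd.continuousAt.preimage_mem_nhds
    (isOpen_compl_singleton.mem_nhds hq')] with z hz
  exact flow_mul φ ψ hz

theorem contDiffAt_flow_slice (φ : ℝ → N.diffGroup) (t : ℝ) {v : V} (hv : v ≠ 0) :
    ContDiffAt ℝ ∞ (fun w => N.flow φ (t, w)) v :=
  N.contDiffAt_homExt (φ t).2.1 hv

/-- Inverse function theorem for `P(t, v) = (t, φ_t v)`. Its derivative is block triangular, and the
block `A` in the `v` direction is invertible because each single `φ_t` has a smooth inverse. -/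
theorem IsSmoothCurve.inv [CompleteSpace V] {ε : ℝ} {φ : ℝ → N.diffGroup}
    (hφ : N.IsSmoothCurve ε φ) : N.IsSmoothCurve ε φ⁻¹ := by
  refine isSmoothCurve_of_contDiffAt fun ⟨t, v⟩ ht hv => ?_
  have hv' : v ≠ 0 := hv
  set w := N.flow φ⁻¹ (t, v) with hw
  have hw0 : w ≠ 0 := flow_ne_zero φ⁻¹ hv
  have hwv : N.flow φ (t, w) = v := flow_flow_inv φ (q := (t, v)) hv
  have hsm : ContDiffAt ℝ ∞ (N.flow φ) (t, w) := hφ.contDiffAt ht hw0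
  let L := fderiv ℝ (N.flow φ) (t, w)
  let A := fderiv ℝ (fun x => N.flow φ (t, x)) w
  let B := fderiv ℝ (fun x => N.flow φ⁻¹ (t, x)) v
  have hL : HasFDerivAt (N.flow φ) L (t, w) := (hsm.differentiableAt (by simp)).hasFDerivAt
  have hA : HasFDerivAt (fun x => N.flow φ (t, x)) A w :=
    ((contDiffAt_flow_slice φ t hw0).differentiableAt (by simp)).hasFDerivAt
  have hB : HasFDerivAt (fun x => N.flow φ⁻¹ (t, x)) B v :=
    ((contDiffAt_flow_slice φ⁻¹ t hv').differentiableAt (by simp)).hasFDerivAt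
  have hLA : ∀ u, L (0, u) = A u := fun u =>
    congrArg (fun T : V →L[ℝ] V => T u)
      ((hL.comp w (hasFDerivAt_prodMk_right t w)).unique hA)
  have hAB : A.comp B = ContinuousLinearMap.id ℝ V := by
    refine HasFDerivAt.unique (hA.comp v hB) ((hasFDerivAt_id v).congr_of_eventuallyEq ?_)
    filter_upwards [isOpen_compl_singleton.mem_nhds hv'] with x hx
    exact flow_flow_inv φ (q := (t, x)) hx
  have hBA : B.comp A = ContinuousLinearMap.id ℝ V := by
    have hB' : HasFDerivAt (fun x => N.flow φ⁻¹ (t, x)) B (N.flow φ (t, w)) := by rwa [hwv]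
    refine HasFDerivAt.unique (hB'.comp w hA) ((hasFDerivAt_id w).congr_of_eventuallyEq ?_)
    filter_upwards [isOpen_compl_singleton.mem_nhds hw0] with x hx
    exact flow_inv_flow φ (q := (t, x)) hx
  have hAB' : ∀ u, A (B u) = u := fun u => congrArg (fun T : V →L[ℝ] V => T u) hAB
  have hBA' : ∀ u, B (A u) = u := fun u => congrArg (fun T : V →L[ℝ] V => T u) hBA
  have hsplit : ∀ z : ℝ × V, L z = L (z.1, 0) + A z.2 := by
    intro z
    rw [← hLA, ← map_add]
    simp
  -- Inverse of the block triangular map `(τ, u) ↦ (τ, L(τ, 0) + A u)`, namely `(τ, u) ↦ (τ, B(u -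
  -- L(τ, 0)))`.
  let e : (ℝ × V) ≃L[ℝ] (ℝ × V) := ContinuousLinearEquiv.equivOfInverse
    ((ContinuousLinearMap.fst ℝ ℝ V).prod L)
    ((ContinuousLinearMap.fst ℝ ℝ V).prod (B.comp (ContinuousLinearMap.snd ℝ ℝ V -
      (L.comp (ContinuousLinearMap.inl ℝ ℝ V)).comp (ContinuousLinearMap.fst ℝ ℝ V))))
    (fun z => by
      refine Prod.ext rfl ?_
      change B (L z - L (z.1, 0)) = z.2
      rw [hsplit z, add_sub_cancel_left, hBA'])
    (fun z => by
      refine Prod.ext rfl ?_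
      change L (z.1, B (z.2 - L (z.1, 0))) = z.2
      rw [hsplit]
      change L (z.1, 0) + A (B (z.2 - L (z.1, 0))) = z.2
      rw [hAB', add_sub_cancel])
  let P : ℝ × V → ℝ × V := fun q => (q.1, N.flow φ q)
  have hP : ContDiffAt ℝ ∞ P (t, w) := contDiffAt_fst.prodMk hsm
  have hP' : HasFDerivAt P (e : (ℝ × V) →L[ℝ] (ℝ × V)) (t, w) := hasFDerivAt_fst.prodMk hL
  have hPw : P (t, w) = (t, v) := Prod.ext rfl hwv
  have hg := hP.to_localInverse hP' (by simp)
  have hr := (hP.hasStrictFDerivAt' hP' (by simp)).eventually_right_inverse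
  have hga : hP.localInverse hP' (by simp) (P (t, w)) = (t, w) :=
    hP.localInverse_apply_image hP' (by simp)
  rw [hPw] at hg hr hga
  refine (contDiffAt_snd.comp (t, v) hg).congr_of_eventuallyEq ?_
  have hc := hg.continuousAt.tendsto
  rw [hga] at hc
  have hne : ∀ᶠ z : ℝ × V in 𝓝 (t, w), z.2 ≠ 0 :=
    continuous_snd.continuousAt.preimage_mem_nhds (isOpen_compl_singleton.mem_nhds hw0)
  -- Near `(t, v)` the local inverse stays off the zero vector, where `P` is injective, so its
  -- second component is `N.flow φ⁻¹`.
  filter_upwards [hr, hc.eventually hne] with z hz hz0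
  change P (hP.localInverse hP' (by simp) z) = z at hz
  change _ = (hP.localInverse hP' (by simp) z).2
  rw [← flow_inv_flow φ hz0]
  exact congrArg (N.flow φ⁻¹) hz.symm

end Flow

end MinkowskiNorm

/-! ### First-order limits of remainders along moving points. -/

/-- Both evaluation points move with `t`, so differentiability at the limit point is not enough;
strict differentiability is. This is why the remainders must be `C^1`. -/
theorem HasStrictFDerivAt.tendsto_inv_pow_smul_sub {V : Type*} [NormedAddCommGroup V]
    [NormedSpace ℝ V] {R : ℝ × V → V} {L : ℝ × V →L[ℝ] V} {y : V}
    (hR : HasStrictFDerivAt R L (0, y)) {w s : ℝ → V} {s₀ : V} (hw : Tendsto w (𝓝[≠] 0) (𝓝 y))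
    (hs : Tendsto s (𝓝[≠] 0) (𝓝 s₀)) {m : ℕ} (hm : 1 ≤ m) :
    Tendsto (fun t : ℝ => (t ^ m)⁻¹ • (R (t, w t + t ^ m • s t) - R (t, w t))) (𝓝[≠] 0)
      (𝓝 (L (0, s₀))) := by
  have ht : Tendsto (fun t : ℝ => t) (𝓝[≠] 0) (𝓝 0) := nhdsWithin_le_nhds
  have htm : Tendsto (fun t : ℝ => t ^ m • s t) (𝓝[≠] 0) (𝓝 0) := by
    have h := (ht.pow m).smul hs
    rwa [zero_pow (by omega), zero_smul] at h
  have hp : Tendsto (fun t : ℝ => ((t, w t + t ^ m • s t), (t, w t))) (𝓝[≠] 0)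
      (𝓝 (((0 : ℝ), y), ((0 : ℝ), y))) := by
    have h := hw.add htm
    rw [add_zero] at h
    exact (ht.prodMk_nhds h).prodMk_nhds (ht.prodMk_nhds hw)
  have h1 := hR.isLittleO.comp_tendsto hp
  have hO : (fun t : ℝ => ((t, w t + t ^ m • s t) : ℝ × V) - (t, w t)) =O[𝓝[≠] 0]
      fun t : ℝ => t ^ m := by
    have h2 : (fun t : ℝ => t ^ m • ((0 : ℝ), s t)) =O[𝓝[≠] 0] fun t : ℝ => t ^ m • (1 : ℝ) :=
      (Asymptotics.isBigO_refl _ _).smul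
        (((tendsto_const_nhds (x := (0 : ℝ))).prodMk_nhds hs).isBigO_one ℝ)
    simpa using h2
  have h3 := (h1.trans_isBigO hO).tendsto_inv_smul_nhds_zero
  have h4 : Tendsto (fun t => L (0, s t)) (𝓝[≠] 0) (𝓝 (L (0, s₀))) :=
    (L.continuous.tendsto _).comp ((tendsto_const_nhds (x := (0 : ℝ))).prodMk_nhds hs)
  have h5 := h3.add h4
  rw [zero_add] at h5
  refine h5.congr' ?_
  filter_upwards [self_mem_nhdsWithin] with t ht0
  have e : ((t, w t + t ^ m • s t) : ℝ × V) - (t, w t) = t ^ m • ((0 : ℝ), s t) := by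
    simp
  simp only [Function.comp_apply, e, map_smul]
  rw [smul_sub _ _ (t ^ m • _), inv_smul_smul₀ (pow_ne_zero m ht0), sub_add_cancel]

/-- Only the spatial derivative of a remainder enters the commutator, and it is read off from the
slice `t = 0`, where the remainder is a multiple of the vector field. -/
theorem fderiv_apply_zero_prodMk {V : Type*} [NormedAddCommGroup V]
    [NormedSpace ℝ V] {R : ℝ × V → V} {v : V} {c : ℝ} {Z : V → V}
    (hR : DifferentiableAt ℝ R (0, v)) (hZ : DifferentiableAt ℝ Z v)
    (e : ∀ᶠ w in 𝓝 v, R (0, w) = c • Z w) (u : V) :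
    fderiv ℝ R (0, v) (0, u) = c • fderiv ℝ Z v u := by
  have h1 : HasFDerivAt (fun w => R (0, w)) _ v :=
    hR.hasFDerivAt.comp v (hasFDerivAt_prodMk_right (0 : ℝ) v)
  exact congrArg (fun T : V →L[ℝ] V => T u)
    (h1.unique ((hZ.hasFDerivAt.const_smul c).congr_of_eventuallyEq e))

/-! ### Vector fields tangent to a subgroup, with the order of their integral curves. -/

namespace MinkowskiNorm

section Tangent

universe u

variable {V : Type u} [NormedAddCommGroup V] [NormedSpace ℝ V] {N : MinkowskiNorm V}

/-- An integral curve of order `k` of `X` has an expansion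
`φ t w = w + t ^ k R(t, w)` with `R(0, w) = X(w) / k!`. -/
theorem IsIntegralCurveOfOrder.exists_expansion [CompleteSpace V] {ε : ℝ} (hε : 0 < ε)
    {φ : ℝ → N.diffGroup} (hφ : N.IsSmoothCurve ε φ) {k : ℕ} {X : N.vectorFields}
    (h : N.IsIntegralCurveOfOrder k φ X) (hk : 1 ≤ k) {v : V} (hv : v ≠ 0) :
    ∃ R : ℝ × V → V, ContDiffAt ℝ 1 R (0, v) ∧
      (∀ᶠ q in 𝓝 ((0 : ℝ), v), N.flow φ q = q.2 + q.1 ^ k • R q) ∧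
      ∀ᶠ w in 𝓝 v, R (0, w) = (k.factorial : ℝ)⁻¹ • N.homExt X.1 w := by
  have hne : ∀ᶠ w in 𝓝 v, w ≠ 0 := isOpen_compl_singleton.mem_nhds hv
  have hder : ∀ (j : ℕ) (w : V) (hw : w ≠ 0), 1 ≤ j →
      iteratedDeriv j (fun t => -w + N.flow φ (t, w)) 0 = N.toFun w •
        iteratedDeriv j (fun t => ((φ t).1 ⟨_, N.smul_mem hw⟩ : V)) 0 := by
    intro j w hw hj
    rw [iteratedDeriv_const_add hj, ← iteratedDeriv_fun_const_smul_field]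
    congr 1
    funext t
    exact flow_of_ne_zero φ t hw
  have hf : ContDiffAt ℝ (1 + k : ℕ) (fun q : ℝ × V => -q.2 + N.flow φ q) (0, v) :=
    contDiffAt_snd.neg.add ((hφ.contDiffAt (by simpa using hε) hv).of_le
      (by exact_mod_cast le_top))
  obtain ⟨R, hR, hR1, hR2⟩ := hf.exists_eq_pow_smul (n := 1) (k := k) (by
    filter_upwards [hne] with w hw j hj
    rcases Nat.eq_zero_or_pos j with rfl | hj0
    -- Order `0` is not covered by the derivative conditions; it comes from `φ 0 = 1`.
    · simp [flow_of_eq_one (φ := φ) (q := ((0 : ℝ), w)) h.1 hw]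
    · rw [hder j w hw hj0, (h.2 _).1 j hj0 hj, smul_zero])
  refine ⟨R, hR, ?_, ?_⟩
  · filter_upwards [hR1] with q hq
    rw [← hq, add_neg_cancel_left]
  · filter_upwards [hR2, hne] with w hw hw0
    rw [hw, hder k w hw0 hk, (h.2 _).2, homExt_of_ne_zero _ hw0]

/-- Criterion used for every new curve below: its smoothness comes from the group operations, so a
pointwise limit of the remainder suffices. -/
theorem isIntegralCurveOfOrder_of_tendsto {ε : ℝ} (hε : 0 < ε) {φ : ℝ → N.diffGroup}
    (hφ : N.IsSmoothCurve ε φ) (h0 : φ 0 = 1) {k : ℕ} {X : N.vectorFields} (hk : 1 ≤ k)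
    (h : ∀ y : N.indicatrix, ∃ T : ℝ → V,
      Tendsto T (𝓝[≠] 0) (𝓝 ((k.factorial : ℝ)⁻¹ • X.1 y)) ∧
      ∀ᶠ t in 𝓝[≠] (0 : ℝ), N.flow φ (t, y) = y + t ^ k • T t) :
    N.IsIntegralCurveOfOrder k φ X := by
  refine ⟨h0, fun y => ?_⟩
  obtain ⟨T, hT, e⟩ := h y
  have hflow : (fun t => ((φ t).1 y : V)) = fun t => N.flow φ (t, y) :=
    funext fun t => (flow_coe φ t y).symm
  have hsm : ContDiffAt ℝ k (fun t => -(y : V) + N.flow φ (t, y)) 0 :=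
    contDiffAt_const.add (ContDiffAt.comp (g := N.flow φ) (f := fun t : ℝ => (t, (y : V))) 0
      ((hφ.contDiffAt (by simpa using hε) (N.ne_zero y)).of_le (by exact_mod_cast le_top))
      (by fun_prop))
  obtain ⟨h1, h2⟩ := iteratedDeriv_of_eventually_eq_pow_smul hsm hT (by
    filter_upwards [e] with t ht
    rw [ht, neg_add_cancel_left])
  rw [hflow]
  refine ⟨fun i hi hik => ?_, ?_⟩
  · rw [← h1 i hik, iteratedDeriv_const_add hi]
  · rw [iteratedDeriv_const_add hk] at h2
    rw [h2, smul_inv_smul₀ (by exact_mod_cast k.factorial_ne_zero)]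

theorem tendsto_flow {ε : ℝ} (hε : 0 < ε) {φ : ℝ → N.diffGroup} (hφ : N.IsSmoothCurve ε φ)
    (h0 : φ 0 = 1) {v : V} (hv : v ≠ 0) {w : ℝ → V} (hw : Tendsto w (𝓝[≠] 0) (𝓝 v)) :
    Tendsto (fun t => (t, N.flow φ (t, w t))) (𝓝[≠] 0) (𝓝 (0, v)) := by
  have ht : Tendsto (fun t : ℝ => t) (𝓝[≠] 0) (𝓝 0) := nhdsWithin_le_nhds
  have h := (hφ.contDiffAt (q := (0, v)) (by simpa using hε) hv).continuousAt.tendsto.comp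
    (ht.prodMk_nhds hw)
  rw [flow_of_eq_one (q := ((0 : ℝ), v)) h0 hv] at h
  exact ht.prodMk_nhds h

variable (N) in
/-- The vector field `X` has an integral curve of order `k ≥ 1` in the subgroup `G`. -/
def IsTangentOfOrder (G : Subgroup N.diffGroup) (k : ℕ) (X : N.vectorFields) : Prop :=
  1 ≤ k ∧ ∃ ε : ℝ, 0 < ε ∧ ∃ φ : ℝ → N.diffGroup, (∀ t ∈ Ioo (-ε) ε, φ t ∈ G) ∧
    N.IsSmoothCurve ε φ ∧ N.IsIntegralCurveOfOrder k φ X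

theorem mem_tangentSet_iff {G : Subgroup N.diffGroup} {X : N.vectorFields} :
    X ∈ N.tangentSet G ↔ ∃ k, N.IsTangentOfOrder G k X := by
  constructor
  · rintro ⟨ε, hε, φ, hG, hφ, k, hk, h⟩
    exact ⟨k, hk, ε, hε, φ, hG, hφ, h⟩
  · rintro ⟨k, hk, ε, hε, φ, hG, hφ, h⟩
    exact ⟨ε, hε, φ, hG, hφ, k, hk, h⟩

variable {G : Subgroup N.diffGroup} {k l : ℕ} {X Y : N.vectorFields}

theorem isTangentOfOrder_zero (G : Subgroup N.diffGroup) : N.IsTangentOfOrder G 1 0 :=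
  ⟨le_rfl, 1, one_pos, 1, fun _ _ => G.one_mem, isSmoothCurve_one 1,
    isIntegralCurveOfOrder_of_tendsto one_pos (isSmoothCurve_one 1) rfl le_rfl fun y =>
      ⟨fun _ => 0, by simp, Eventually.of_forall fun t => by
        simp [flow_of_eq_one (φ := (1 : ℝ → N.diffGroup)) (q := (t, (y : V))) rfl (N.ne_zero y)]⟩⟩

variable [CompleteSpace V]

/-- Replacing `t` by `a t^l` turns `t^k R` into `t^(kl) a^k R`, with leading coefficient `a^k X /
k!`; multiplying by `(kl)!` gives the derivative. -/
theorem IsTangentOfOrder.reparam (hX : N.IsTangentOfOrder G k X) (a : ℝ) (hl : 1 ≤ l) :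
    N.IsTangentOfOrder G (k * l)
      ((((k * l).factorial : ℝ) * (k.factorial : ℝ)⁻¹ * a ^ k) • X) := by
  obtain ⟨hk, ε, hε, φ, hG, hφ, h⟩ := hX
  have hσ : ContDiff ℝ ∞ fun t : ℝ => a * t ^ l := by fun_prop
  have hσ0 : a * (0 : ℝ) ^ l = 0 := by rw [zero_pow (by omega), mul_zero]
  have hσt : Tendsto (fun t : ℝ => a * t ^ l) (𝓝 0) (𝓝 0) := by
    simpa only [hσ0] using hσ.continuous.tendsto 0
  obtain ⟨δ, hδ, hball⟩ := Metric.eventually_nhds_iff_ball.1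
    (hσt.eventually (Ioo_mem_nhds (neg_neg_of_pos hε) hε))
  have hmaps : MapsTo (fun t : ℝ => a * t ^ l) (Ioo (-δ) δ) (Ioo (-ε) ε) := fun t ht =>
    hball t (by rw [Real.ball_eq_Ioo]; simpa using ht)
  have hφσ := hφ.reparam hσ hmaps
  have hkl : 1 ≤ k * l := Nat.one_le_iff_ne_zero.2 (by positivity)
  refine ⟨hkl, δ, hδ, _, fun t ht => hG _ (hmaps ht), hφσ,
    isIntegralCurveOfOrder_of_tendsto hδ hφσ ?_ hkl fun y => ?_⟩
  · simp only [Function.comp_apply, hσ0, h.1]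
  · obtain ⟨R, hR, hR1, hR2⟩ := h.exists_expansion hε hφ hk (N.ne_zero y)
    have hq : Tendsto (fun t : ℝ => (a * t ^ l, (y : V))) (𝓝[≠] 0) (𝓝 (0, (y : V))) :=
      (hσt.mono_left nhdsWithin_le_nhds).prodMk_nhds tendsto_const_nhds
    refine ⟨fun t => a ^ k • R (a * t ^ l, y), ?_, ?_⟩
    · have h1 := (hR.continuousAt.tendsto.comp hq).const_smul (a ^ k)
      rw [hR2.self_of_nhds, homExt_apply] at h1
      have hf : ((k * l).factorial : ℝ) ≠ 0 := by exact_mod_cast (k * l).factorial_ne_zero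
      have e : ((k * l).factorial : ℝ)⁻¹ •
          (((k * l).factorial : ℝ) * (k.factorial : ℝ)⁻¹ * a ^ k) • X.1 y =
          a ^ k • (k.factorial : ℝ)⁻¹ • X.1 y := by
        rw [smul_smul, smul_smul, mul_assoc, inv_mul_cancel_left₀ hf, mul_comm]
      exact e ▸ h1
    · filter_upwards [hq.eventually hR1] with t ht
      refine ht.trans ?_
      simp only [smul_smul]
      congr 2
      ring

/-- With `z = φ_t⁻¹ y`, the expansion `y = z + t^k R(t, z)` reads `z = y - t^k R(t, z)`, and `z →
y`. -/
theorem IsTangentOfOrder.neg (hX : N.IsTangentOfOrder G k X) : N.IsTangentOfOrder G k (-X) := by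
  obtain ⟨hk, ε, hε, φ, hG, hφ, h⟩ := hX
  have hφ0 : φ⁻¹ 0 = 1 := by simp [h.1]
  refine ⟨hk, ε, hε, φ⁻¹, fun t ht => G.inv_mem (hG t ht), hφ.inv,
    isIntegralCurveOfOrder_of_tendsto hε hφ.inv hφ0 hk fun y => ?_⟩
  obtain ⟨R, hR, hR1, hR2⟩ := h.exists_expansion hε hφ hk (N.ne_zero y)
  have hq := tendsto_flow hε hφ.inv hφ0 (N.ne_zero y) (tendsto_const_nhds (x := (y : V)))
  refine ⟨fun t => -R (t, N.flow φ⁻¹ (t, y)), ?_, ?_⟩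
  · have h1 := (hR.continuousAt.tendsto.comp hq).neg
    rw [hR2.self_of_nhds, homExt_apply] at h1
    simpa using h1
  · filter_upwards [hq.eventually hR1] with t ht
    have h1 : (y : V) = _ := (flow_flow_inv φ (q := (t, (y : V))) (N.ne_zero y)).symm.trans ht
    rw [smul_neg, ← sub_eq_add_neg, eq_sub_iff_add_eq]
    exact h1.symm

theorem IsTangentOfOrder.smul (hX : N.IsTangentOfOrder G k X) {c : ℝ} (hc : c ≠ 0) (hl : 1 ≤ l) :
    N.IsTangentOfOrder G (k * l) (c • X) := by
  have key : ∀ {Y : N.vectorFields} {d : ℝ}, N.IsTangentOfOrder G k Y → 0 < d →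
      N.IsTangentOfOrder G (k * l) (d • Y) := by
    intro Y d hY hd
    have h1 : (0 : ℝ) < k.factorial := by exact_mod_cast k.factorial_pos
    have h2 : (0 : ℝ) < (k * l).factorial := by exact_mod_cast (k * l).factorial_pos
    -- The parameter `a` solves `(kl)! a^k / k! = d`; the real root exists because `d > 0`.
    have h := hY.reparam ((d * k.factorial / (k * l).factorial) ^ ((k : ℝ)⁻¹)) hl
    have hk := hY.1
    rw [Real.rpow_inv_natCast_pow (by positivity) (by omega)] at h
    convert h using 2
    field_simp
  rcases lt_or_gt_of_ne hc with h | h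
  · simpa using key hX.neg (neg_pos.2 h)
  · exact key hX h

theorem IsTangentOfOrder.add (hX : N.IsTangentOfOrder G k X) (hY : N.IsTangentOfOrder G k Y) :
    N.IsTangentOfOrder G k (X + Y) := by
  obtain ⟨hk, ε₁, hε₁, φ, hGφ, hφ, h⟩ := hX
  obtain ⟨-, ε₂, hε₂, ψ, hGψ, hψ, h'⟩ := hY
  have hε : 0 < min ε₁ ε₂ := lt_min hε₁ hε₂
  replace hφ := hφ.mono (min_le_left ε₁ ε₂)
  replace hψ := hψ.mono (min_le_right ε₁ ε₂)
  refine ⟨hk, _, hε, φ * ψ, fun t ht => ?_, hφ.mul hψ,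
    isIntegralCurveOfOrder_of_tendsto hε (hφ.mul hψ) (by simp [h.1, h'.1]) hk fun y => ?_⟩
  · have h1 := abs_lt.2 ht
    exact G.mul_mem (hGφ t (abs_lt.1 (h1.trans_le (min_le_left _ _))))
      (hGψ t (abs_lt.1 (h1.trans_le (min_le_right _ _))))
  have hy := N.ne_zero y
  obtain ⟨R, hR, hR1, hR2⟩ := h.exists_expansion hε hφ hk hy
  obtain ⟨S, hS, hS1, hS2⟩ := h'.exists_expansion hε hψ hk hy
  have hq := tendsto_flow hε hψ h'.1 hy (tendsto_const_nhds (x := (y : V)))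
  have hq' : Tendsto (fun t : ℝ => (t, (y : V))) (𝓝[≠] 0) (𝓝 (0, (y : V))) :=
    Tendsto.prodMk_nhds nhdsWithin_le_nhds tendsto_const_nhds
  refine ⟨fun t => R (t, N.flow ψ (t, y)) + S (t, y), ?_, ?_⟩
  · have h1 := (hR.continuousAt.tendsto.comp hq).add (hS.continuousAt.tendsto.comp hq')
    rw [hR2.self_of_nhds, hS2.self_of_nhds, homExt_apply, homExt_apply, ← smul_add] at h1
    exact h1
  · filter_upwards [hq.eventually hR1, hq'.eventually hS1] with t h1 h2
    rw [flow_mul φ ψ hy, h1, smul_add]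
    rw [h2]
    abel

/-- Writing the commutator as `φψ(ψφ)⁻¹` and putting `w = (ψφ)⁻¹ y`, the displacement of `y` is `φψw
- ψφw`. The terms `t^k R(t, w)` and `t^l S(t, w)` cancel, leaving `t^k (R(t, ψw) - R(t, w)) - t^l
(S(t, φw) - S(t, w))`, of order `k + l`. -/
theorem IsTangentOfOrder.commutator (hX : N.IsTangentOfOrder G k X)
    (hY : N.IsTangentOfOrder G l Y) :
    N.IsTangentOfOrder G (k + l)
      (-(((k + l).factorial : ℝ) * (k.factorial : ℝ)⁻¹ * (l.factorial : ℝ)⁻¹) • ⁅X, Y⁆) := by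
  obtain ⟨hk, ε₁, hε₁, φ, hGφ, hφ, h⟩ := hX
  obtain ⟨hl, ε₂, hε₂, ψ, hGψ, hψ, h'⟩ := hY
  have hε : 0 < min ε₁ ε₂ := lt_min hε₁ hε₂
  replace hφ := hφ.mono (min_le_left ε₁ ε₂)
  replace hψ := hψ.mono (min_le_right ε₁ ε₂)
  have hs : N.IsSmoothCurve (min ε₁ ε₂) (φ * ψ * (ψ * φ)⁻¹) := (hφ.mul hψ).mul (hψ.mul hφ).inv
  have hkl : 1 ≤ k + l := by omega
  refine ⟨hkl, _, hε, φ * ψ * (ψ * φ)⁻¹, fun t ht => ?_, hs,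
    isIntegralCurveOfOrder_of_tendsto hε hs (by simp [h.1, h'.1]) hkl fun y => ?_⟩
  · have h1 := abs_lt.2 ht
    have h2 := hGφ t (abs_lt.1 (h1.trans_le (min_le_left _ _)))
    have h3 := hGψ t (abs_lt.1 (h1.trans_le (min_le_right _ _)))
    exact G.mul_mem (G.mul_mem h2 h3) (G.inv_mem (G.mul_mem h3 h2))
  have hy := N.ne_zero y
  obtain ⟨R, hR, hR1, hR2⟩ := h.exists_expansion hε hφ hk hy
  obtain ⟨S, hS, hS1, hS2⟩ := h'.exists_expansion hε hψ hl hy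
  let w : ℝ → V := fun t => N.flow (ψ * φ)⁻¹ (t, y)
  have hw0 : ∀ t, w t ≠ 0 := fun t => flow_ne_zero _ (q := (t, (y : V))) hy
  have hw' : Tendsto (fun t => (t, w t)) (𝓝[≠] 0) (𝓝 (0, (y : V))) :=
    tendsto_flow hε (hψ.mul hφ).inv (by simp [h.1, h'.1]) hy (tendsto_const_nhds (x := (y : V)))
  have hw : Tendsto w (𝓝[≠] 0) (𝓝 (y : V)) := (continuous_snd.tendsto _).comp hw'
  have hqφ := tendsto_flow hε hφ h.1 hy hw
  have hqψ := tendsto_flow hε hψ h'.1 hy hw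
  have hRw := hR.continuousAt.tendsto.comp hw'
  have hSw := hS.continuousAt.tendsto.comp hw'
  have l1 := (hR.hasStrictFDerivAt one_ne_zero).tendsto_inv_pow_smul_sub hw hSw hl
  have l2 := (hS.hasStrictFDerivAt one_ne_zero).tendsto_inv_pow_smul_sub hw hRw hk
  refine ⟨fun t => (t ^ l)⁻¹ • (R (t, w t + t ^ l • S (t, w t)) - R (t, w t)) -
      (t ^ k)⁻¹ • (S (t, w t + t ^ k • R (t, w t)) - S (t, w t)), ?_, ?_⟩
  -- The limit is `(DX·Y - DY·X)/(k! l!)`; the bracket convention is `DY·X - DX·Y`, whence the minus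
  -- sign.
  · convert l1.sub l2 using 2
    · rfl
    rw [fderiv_apply_zero_prodMk (hR.differentiableAt one_ne_zero)
      (N.differentiableAt_homExt X y) hR2,
      fderiv_apply_zero_prodMk (hS.differentiableAt one_ne_zero)
      (N.differentiableAt_homExt Y y) hS2, hR2.self_of_nhds, hS2.self_of_nhds, map_smul, map_smul]
    change ((k + l).factorial : ℝ)⁻¹ • (-(((k + l).factorial : ℝ) * (k.factorial : ℝ)⁻¹ *
      (l.factorial : ℝ)⁻¹)) • (fderiv ℝ (N.homExt Y.1) y (N.homExt X.1 y) -
        fderiv ℝ (N.homExt X.1) y (N.homExt Y.1 y)) = _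
    have hf : ((k + l).factorial : ℝ) ≠ 0 := by exact_mod_cast (k + l).factorial_ne_zero
    rw [smul_smul, mul_neg, ← mul_assoc, ← mul_assoc, inv_mul_cancel₀ hf, one_mul, neg_smul,
      ← smul_neg, neg_sub, smul_sub, smul_smul, smul_smul, mul_comm (l.factorial : ℝ)⁻¹]
  · filter_upwards [hqφ.eventually hS1, hqψ.eventually hR1, hw'.eventually hR1, hw'.eventually hS1,
      self_mem_nhdsWithin] with t h1 h2 h3 h4 ht0
    have hχ : N.flow (φ * ψ * (ψ * φ)⁻¹) (t, y) = N.flow φ (t, N.flow ψ (t, w t)) :=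
      (flow_mul (φ * ψ) (ψ * φ)⁻¹ (q := (t, (y : V))) hy).trans
        (flow_mul φ ψ (q := (t, w t)) (hw0 t))
    have hyw : (y : V) = N.flow ψ (t, N.flow φ (t, w t)) :=
      (flow_flow_inv (ψ * φ) (q := (t, (y : V))) hy).symm.trans
        (flow_mul ψ φ (q := (t, w t)) (hw0 t))
    rw [h1, h3] at hyw
    rw [hχ, h2, h4, smul_sub (t ^ (k + l))]
    have hk0 : t ^ k ≠ 0 := pow_ne_zero k ht0
    have hl0 : t ^ l ≠ 0 := pow_ne_zero l ht0
    rw [pow_add, mul_smul, smul_inv_smul₀ hl0, mul_comm, mul_smul, smul_inv_smul₀ hk0]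
    rw [hyw]
    rw [smul_sub, smul_sub]
    abel

theorem IsTangentOfOrder.lie (hX : N.IsTangentOfOrder G k X) (hY : N.IsTangentOfOrder G l Y) :
    N.IsTangentOfOrder G (k + l) ⁅X, Y⁆ := by
  have h := hX.commutator hY
  have hc : -(((k + l).factorial : ℝ) * (k.factorial : ℝ)⁻¹ * (l.factorial : ℝ)⁻¹) ≠ 0 := by
    have := (k + l).factorial_ne_zero
    have := k.factorial_ne_zero
    have := l.factorial_ne_zero
    simp [*]
  simpa only [smul_smul, inv_mul_cancel₀ hc, one_smul, mul_one] using
    h.smul (inv_ne_zero hc) le_rfl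

variable (N) in
/-- The vector fields tangent to a subgroup of the diffeomorphism group of the indicatrix form a
Lie algebra. -/
def tangentLieSubalgebra (G : Subgroup N.diffGroup) : LieSubalgebra ℝ N.vectorFields where
  carrier := N.tangentSet G
  zero_mem' := mem_tangentSet_iff.2 ⟨1, isTangentOfOrder_zero G⟩
  add_mem' {X Y} hX hY := by
    obtain ⟨k, hX⟩ := mem_tangentSet_iff.1 hX
    obtain ⟨l, hY⟩ := mem_tangentSet_iff.1 hY
    -- Scaling by `1` serves to raise both curves to the common order `k * l`.
    have h1 := hX.smul one_ne_zero hY.1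
    have h2 := hY.smul one_ne_zero hX.1
    rw [one_smul] at h1 h2
    rw [mul_comm] at h2
    exact mem_tangentSet_iff.2 ⟨_, h1.add h2⟩
  smul_mem' c X hX := by
    obtain ⟨k, hX⟩ := mem_tangentSet_iff.1 hX
    -- `IsTangentOfOrder.smul` excludes `c = 0`; the constant curve covers it.
    rcases eq_or_ne c 0 with rfl | hc
    · rw [zero_smul]
      exact mem_tangentSet_iff.2 ⟨1, isTangentOfOrder_zero G⟩
    · exact mem_tangentSet_iff.2 ⟨_, hX.smul hc le_rfl⟩
  lie_mem' {X Y} hX hY := by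
    obtain ⟨k, hX⟩ := mem_tangentSet_iff.1 hX
    obtain ⟨l, hY⟩ := mem_tangentSet_iff.1 hY
    exact mem_tangentSet_iff.2 ⟨_, hX.lie hY⟩

end Tangent

end MinkowskiNorm

theorem mainTheorem9 (n : ℕ) (M : Type*) [TopologicalSpace M]
    [ChartedSpace (EuclideanSpace ℝ (Fin n)) M] [IsManifold (𝓡 n) ∞ M]
    (F : FinslerMetric n M) (p : M) :
    ∃ 𝔥 : LieSubalgebra ℝ (F.fiber p).vectorFields,
      (𝔥 : Set (F.fiber p).vectorFields) = F.holonomyAlgebra p :=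
  ⟨(F.fiber p).tangentLieSubalgebra (F.holonomyGroup p), rfl⟩
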